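/- Let $0<q<1$ and $\alpha>-3/2$ with $\alpha\neq -1$. Write $(a;q)_k=\prod_{i=0}^{k-1}(1-aq^i)$ and $(a;q)_\infty=\prod_{i\ge 0}(1-aq^i)$; let $$J_\alpha(x,\lambda;q^2)=\sum_{k=0}^\infty \frac{(-1/x^2;q^2)_k}{(q^2;q^2)_k\,(q^{2\alpha+2};q^2)_k}(-1)^k q^{k(k-1)}\bigl(\lambda^2x^2q^{2\alpha+2}\bigr)^k \qquad (x\neq 0)$$ be the big $q$-Bessel function, let $\int_0^1 f(x)\,d_qx=(1-q)\sum_{n\ge 0}f(q^n)q^n$ be the Jackson $q$-integral, and let $w_\alpha(x)=\dfrac{x(-x^2q^2;q^2)_\infty}{(-x^2q^{2\alpha+4};q^2)_\infty}$. (i) Let $g$ be a complex-valued function in $L^1_q(0,1)$, i.e. $\sum_{n\ge 0}|g(q^n)|q^n<\infty$. If $$\int_0^1 w_\alpha(x)\,g(x)\,J_{\alpha+1}(x,j;q^2)\,d_qx=0$$ for every positive zero $j$ of $\lambda\mapsto J_\alpha(1,\lambda;q^2)$, then $g(q^m)=0$ for all $m=0,1,2,\dots$. (ii) The functions $x\mapsto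 J_{\alpha+1}(x,j;q^2)$, where $j$ runs over the positive zeros of $\lambda\mapsto J_\alpha(1,\lambda;q^2)$, form a complete system in the complex Hilbert space $L^2_q\bigl((0,1);w_\alpha(x)\,d_qx\bigr)$, i.e. their linear span is dense in it. -/

import Mathlib

open MeasureTheory

noncomputable section

/-- The `q`-shifted factorial `(a; q)_n = ∏_{i<n} (1 - a q^i)`. -/
def qShifted {R : Type*} [CommRing R] (a q : R) (n : ℕ) : R :=
  ∏ i ∈ Finset.range n, (1 - a * q ^ i)

/-- The infinite `q`-shifted factorial `(a; q)_∞ = ∏_{i≥0} (1 - a q^i)`. -/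
def qShiftedInf (a q : ℝ) : ℝ :=
  ∏' i : ℕ, (1 - a * q ^ i)

/-- The basic hypergeometric series `₁φ₁(a; b | q, z)`. -/
def phi11 (a b q z : ℂ) : ℂ :=
  ∑' k : ℕ, qShifted a q k / (qShifted q q k * qShifted b q k)
    * (-1) ^ k * q ^ (k.choose 2) * z ^ k

/-- The big `q`-Bessel function
`J_α(x, l; q²) = ₁φ₁(-1/x²; q^{2α+2} | q²; l² x² q^{2α+2})`, for `x ≠ 0`. -/
def bigQBessel (q α : ℝ) (x l : ℂ) : ℂ :=
  phi11 (-1 / x ^ 2) ((q ^ (2 * α + 2) : ℝ) : ℂ) ((q : ℂ) ^ 2)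
    (l ^ 2 * x ^ 2 * ((q ^ (2 * α + 2) : ℝ) : ℂ))

/-- The Jackson `q`-integral `∫_0^a f(t) d_q t = (1 - q) a ∑_{n≥0} f(a q^n) q^n`. -/
def qIntegral (q a : ℝ) (f : ℝ → ℂ) : ℂ :=
  (1 - (q : ℂ)) * (a : ℂ) * ∑' n : ℕ, f (a * q ^ n) * (q : ℂ) ^ n

/-- `f ∈ L¹_q(0, a)`: the `q`-integral of `|f|` over `(0, a)` is finite. -/
def QIntegrable (q a : ℝ) (f : ℝ → ℂ) : Prop :=
  Summable fun n : ℕ => ‖f (a * q ^ n)‖ * q ^ n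

/-- The weight `x (-x² q²; q²)_∞ / (-x² q^{2α+4}; q²)_∞`. -/
def besselWeight (q α x : ℝ) : ℝ :=
  x * qShiftedInf (-x ^ 2 * q ^ 2) (q ^ 2)
    / qShiftedInf (-x ^ 2 * q ^ (2 * α + 4)) (q ^ 2)

/-- The measure `besselWeight q α x d_q x` on `(0, 1)`: the point `q^n` has mass
`(1 - q) q^n * besselWeight q α (q^n)`. -/
def besselMeasure (q α : ℝ) : Measure ℝ :=
  Measure.sum fun n : ℕ =>
    ENNReal.ofReal ((1 - q) * q ^ n * besselWeight q α (q ^ n)) • Measure.dirac (q ^ n)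

/-- The positive zeros `j_n^α` of `l ↦ J_α(1, l; q²)`. -/
def besselZeros (q α : ℝ) : Set ℝ :=
  {l : ℝ | 0 < l ∧ bigQBessel q α 1 (l : ℂ) = 0}

end

/-!
The theorem is an instance of the spectral theorem for compact self-adjoint operators. In the
variables `y = x²`, `z = λ²`, `p = q²`, `b = q^{2α+2}` the functions `J_α` and `J_{α+1}` become
`U = besselSeries p b y z` and `v = besselSeries p (b * p) y z`, power series in `z` whose
coefficients are polynomials in `y`; so they are defined at the negative points `y = -p^n` too.
There they satisfy two first-order relations (`besselSeries_sub`,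
`latticeWeight_mul_besselSeries_sub`): the `p`-difference of `U` is a multiple of `z y v`, and the
`p`-difference of `w v`, where `w` is the weight, is a multiple of `y U` times a second weight.

Summing these relations along the two-sided lattice `-1 < -p < -p² < ⋯ < 0 < ⋯ < p² < p < 1`, with
the boundary condition `U(1) = 0`, gives `v = b z T v` for an operator `T = Aᵗ δ A` on the weighted
`ℓ²` space of the lattice, with `A` a summation operator and `δ` a summable diagonal. Hence `T` is
compact and symmetric; it is injective, and each of its eigenvectors is a multiple of some `v(·, z)`
with `U(1, z) = 0`: an eigenvector solves the first-order system, whose solutions are determined by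
their value at `y = -1` (`LatticeSystem.eq_zero`, `eigenvector_eq_besselSeries`).

A function `g` on the points `p^n` that is orthogonal to `v(·, j²)` for all positive zeros `j`,
extended by zero to the negative half of the lattice, is therefore orthogonal to all eigenvectors
with positive eigenvalue. A negative eigenvalue exists when `b > 1`, that is `α < -1`, but it is
simple and unique: for `z < 0` the function `v(·, z)` is positive on the lattice, and two positive
functions are not orthogonal (`inner_ne_zero_of_neg`). So `g` is a multiple of a single
eigenvector, which does not vanish at `y = -1`, where `g` does; hence `g = 0`
(`eq_zero_of_orthogonal_pos_eigenvectors`, `eq_zero_of_forall_besselSeries_zero`). Both parts of the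
theorem follow, since `L¹_q` and the weighted `L²_q` both embed into the `ℓ²` space used here.
-/

open Filter Topology

noncomputable section

/-! ### The series `∑ e_k(b) z^k ∏_{i<k} (y + p^i)` -/

/-- The polynomial `∏_{i<k} (y + p^i)`, which equals `y^k (-1/y; p)_k` for `y ≠ 0`. -/
def shiftPoly (p : ℝ) (k : ℕ) (y : ℝ) : ℝ :=
  ∏ i ∈ Finset.range k, (y + p ^ i)

/-- The coefficient `(-b)^k p^{k(k-1)/2} / ((p; p)_k (b; p)_k)`. -/
def besselCoeff (p b : ℝ) (k : ℕ) : ℝ :=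
  (-b) ^ k * p ^ (k.choose 2) / (qShifted p p k * qShifted b p k)

/-- The big `q`-Bessel function in the variables `y = x²`, `z = λ²`, with base `p = q²` and
parameter `b = q^{2α+2}`. In contrast with `bigQBessel` it is also meaningful at `y ≤ 0`. -/
def besselSeries (p b y z : ℝ) : ℝ :=
  ∑' k : ℕ, besselCoeff p b k * z ^ k * shiftPoly p k y

lemma qShifted_succ {R : Type*} [CommRing R] (a q : R) (n : ℕ) :
    qShifted a q (n + 1) = qShifted a q n * (1 - a * q ^ n) :=
  Finset.prod_range_succ _ _

lemma qShifted_succ' {R : Type*} [CommRing R] (a q : R) (n : ℕ) :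
    qShifted a q (n + 1) = (1 - a) * qShifted (a * q) q n := by
  simp only [qShifted, Finset.prod_range_succ']
  rw [mul_comm]
  simp [pow_succ', mul_assoc]

lemma qShifted_ne_zero {p b : ℝ} (hb : ∀ k : ℕ, b * p ^ k ≠ 1) (n : ℕ) : qShifted b p n ≠ 0 :=
  Finset.prod_ne_zero_iff.2 fun i _ => sub_ne_zero.2 (hb i).symm

lemma mul_pow_ne_one {p b : ℝ} (hp0 : 0 < p) (hp1 : p < 1) (hb1 : b < 1) (k : ℕ) :
    b * p ^ k ≠ 1 := by
  have h1 : p ^ k ≤ 1 := pow_le_one₀ hp0.le hp1.le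
  have h2 : 0 < p ^ k := pow_pos hp0 k
  intro h
  nlinarith

lemma mul_pow_ne_one_of_mul_lt_one {p b : ℝ} (hp0 : 0 < p) (hp1 : p < 1) (hb : b ≠ 1)
    (hbp : b * p < 1) : ∀ k : ℕ, b * p ^ k ≠ 1
  | 0 => by simpa using hb
  | k + 1 => by
    rw [pow_succ', ← mul_assoc]
    exact mul_pow_ne_one hp0 hp1 hbp k

lemma besselCoeff_zero (p b : ℝ) : besselCoeff p b 0 = 1 := by
  simp [besselCoeff, qShifted]

lemma besselCoeff_succ {p b : ℝ} (k : ℕ) :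
    besselCoeff p b (k + 1)
      = besselCoeff p b k * (-b * p ^ k / ((1 - p * p ^ k) * (1 - b * p ^ k))) := by
  simp only [besselCoeff, qShifted_succ, Nat.choose_succ_succ' k 1, Nat.choose_one_right, pow_add,
    pow_succ (-b), div_mul_div_comm]
  congr 1 <;> ring

lemma besselCoeff_ne_zero {p b : ℝ} (hp0 : 0 < p) (hp1 : p < 1) (hb0 : 0 < b)
    (hb : ∀ k : ℕ, b * p ^ k ≠ 1) (k : ℕ) : besselCoeff p b k ≠ 0 :=
  div_ne_zero (mul_ne_zero (pow_ne_zero _ (neg_ne_zero.2 hb0.ne')) (pow_ne_zero _ hp0.ne'))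
    (mul_ne_zero (qShifted_ne_zero (mul_pow_ne_one hp0 hp1 hp1) k) (qShifted_ne_zero hb k))

/-- The coefficient relation behind the lowering formula `besselSeries_sub`. -/
lemma besselCoeff_succ_mul {p b : ℝ} (hp0 : 0 < p) (hp1 : p < 1)
    (k : ℕ) :
    besselCoeff p b (k + 1) * (1 - p ^ (k + 1)) = -(b / (1 - b)) * besselCoeff p (b * p) k := by
  have h2 : (1 - p * p ^ k) ≠ 0 := sub_ne_zero.2 (mul_pow_ne_one hp0 hp1 hp1 k).symm
  have h5 : besselCoeff p b (k + 1) = (-b) ^ (k + 1) * p ^ ((k + 1).choose 2)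
      / ((qShifted p p k * (1 - p * p ^ k)) * ((1 - b) * qShifted (b * p) p k)) := by
    rw [besselCoeff, qShifted_succ p, qShifted_succ' b]
  rw [h5, besselCoeff, Nat.choose_succ_succ' k 1, Nat.choose_one_right, pow_add, pow_succ (-b),
    pow_succ' p, show -(b * p) = -b * p by ring, mul_pow, div_mul_eq_mul_div, ← neg_div,
    div_mul_div_comm]
  rw [show qShifted p p k * (1 - p * p ^ k) * ((1 - b) * qShifted (b * p) p k)
    = ((1 - b) * (qShifted p p k * qShifted (b * p) p k)) * (1 - p * p ^ k) by ring,
    mul_div_mul_right _ _ h2]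
  congr 1
  ring

/-- The coefficient relation behind the raising formula `besselSeries_raise`. -/
lemma besselCoeff_mul_one_sub {p b : ℝ} (hb : ∀ k : ℕ, b * p ^ k ≠ 1) (k : ℕ) :
    besselCoeff p (b * p) k * (1 - b * p ^ k) = (1 - b) * p ^ k * besselCoeff p b k := by
  have h3 := qShifted_ne_zero hb (k + 1)
  have h3' := h3
  rw [qShifted_succ] at h3
  rw [qShifted_succ'] at h3'
  have key : qShifted b p k * (1 - b * p ^ k) = (1 - b) * qShifted (b * p) p k := by
    rw [← qShifted_succ, qShifted_succ']
  have h4 := right_ne_zero_of_mul h3'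
  have h5 := left_ne_zero_of_mul h3
  by_cases h1 : qShifted p p k = 0
  · simp [besselCoeff, h1]
  rw [besselCoeff, besselCoeff, show -(b * p) = -b * p by ring, mul_pow]
  field_simp
  linear_combination ((-b) ^ k * p ^ k * p ^ k.choose 2) * key

lemma abs_shiftPoly_le {p y : ℝ} (hp0 : 0 < p) (hp1 : p < 1) (hy : |y| ≤ 1) (k : ℕ) :
    |shiftPoly p k y| ≤ 2 ^ k := by
  rw [shiftPoly, Finset.abs_prod]
  calc _ ≤ ∏ i ∈ Finset.range k, (2 : ℝ) := by
        refine Finset.prod_le_prod (fun _ _ => abs_nonneg _) fun i _ => ?_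
        have h1 : p ^ i ≤ 1 := pow_le_one₀ hp0.le hp1.le
        have h2 : 0 < p ^ i := pow_pos hp0 i
        rw [abs_le] at hy ⊢
        constructor <;> linarith [hy.1, hy.2]
    _ = 2 ^ k := by simp

/-- The coefficients decay superexponentially, so the series is entire in `z`. -/
lemma summable_abs_besselCoeff {p b : ℝ} (hp0 : 0 < p) (hp1 : p < 1) (hb0 : 0 < b)
    (hb : ∀ k : ℕ, b * p ^ k ≠ 1) {R : ℝ} (hR : 0 < R) :
    Summable fun k => |besselCoeff p b k| * R ^ k := by
  have hne : ∀ k, |besselCoeff p b k| * R ^ k ≠ 0 := fun k =>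
    mul_ne_zero (abs_ne_zero.2 (besselCoeff_ne_zero hp0 hp1 hb0 hb k)) (pow_ne_zero _ hR.ne')
  refine summable_of_ratio_test_tendsto_lt_one (l := 0) zero_lt_one
    (Eventually.of_forall hne) ?_
  have hpk : Tendsto (fun k : ℕ => p ^ k) atTop (𝓝 0) :=
    tendsto_pow_atTop_nhds_zero_of_lt_one hp0.le hp1
  have h1 : Tendsto (fun k : ℕ => |-b * p ^ k / ((1 - p * p ^ k) * (1 - b * p ^ k))| * R) atTop
      (𝓝 (|-b * 0 / ((1 - p * 0) * (1 - b * 0))| * R)) := by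
    refine Tendsto.mul_const _ (Tendsto.abs ?_)
    refine Tendsto.div (hpk.const_mul _) (Tendsto.mul ?_ ?_) (by simp)
    · exact (hpk.const_mul _).const_sub _
    · exact (hpk.const_mul _).const_sub _
  simp only [mul_zero, sub_zero, zero_div, abs_zero, zero_mul] at h1
  refine h1.congr fun k => ?_
  rw [besselCoeff_succ, Real.norm_of_nonneg (by positivity), Real.norm_of_nonneg (by positivity),
    abs_mul, pow_succ]
  have h2 := abs_ne_zero.2 (besselCoeff_ne_zero hp0 hp1 hb0 hb k)
  have h3 := pow_ne_zero k hR.ne'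
  field_simp

section series

variable {p b : ℝ}

lemma summable_besselSeries_bound (hp0 : 0 < p) (hp1 : p < 1) (hb0 : 0 < b)
    (hb : ∀ k : ℕ, b * p ^ k ≠ 1) (z : ℝ) :
    Summable fun k => |besselCoeff p b k| * (2 * (|z| + 1)) ^ k :=
  summable_abs_besselCoeff hp0 hp1 hb0 hb (by positivity)

lemma abs_besselSeries_term_le (hp0 : 0 < p) (hp1 : p < 1) (z : ℝ) {y : ℝ} (hy : |y| ≤ 1) (k : ℕ) :
    |besselCoeff p b k * z ^ k * shiftPoly p k y| ≤ |besselCoeff p b k| * (2 * (|z| + 1)) ^ k := by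
  rw [abs_mul, abs_mul, abs_pow, mul_assoc, mul_pow]
  refine mul_le_mul_of_nonneg_left ?_ (abs_nonneg _)
  rw [mul_comm]
  refine mul_le_mul (abs_shiftPoly_le hp0 hp1 hy k) ?_ (by positivity) (by positivity)
  exact pow_le_pow_left₀ (abs_nonneg _) (by linarith) k

lemma hasSum_besselSeries (hp0 : 0 < p) (hp1 : p < 1) (hb0 : 0 < b)
    (hb : ∀ k : ℕ, b * p ^ k ≠ 1) (z : ℝ) {y : ℝ} (hy : |y| ≤ 1) :
    HasSum (fun k => besselCoeff p b k * z ^ k * shiftPoly p k y) (besselSeries p b y z) :=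
  (Summable.of_norm_bounded (summable_besselSeries_bound hp0 hp1 hb0 hb z)
    fun k => abs_besselSeries_term_le hp0 hp1 z hy k).hasSum

lemma exists_abs_besselSeries_le (hp0 : 0 < p) (hp1 : p < 1) (hb0 : 0 < b)
    (hb : ∀ k : ℕ, b * p ^ k ≠ 1) (z : ℝ) :
    ∃ C : ℝ, ∀ y : ℝ, |y| ≤ 1 → |besselSeries p b y z| ≤ C :=
  ⟨_, fun y hy => tsum_of_norm_bounded (f := fun k => besselCoeff p b k * z ^ k * shiftPoly p k y)
    (summable_besselSeries_bound hp0 hp1 hb0 hb z).hasSum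
    fun k => abs_besselSeries_term_le hp0 hp1 z hy k⟩

lemma continuousOn_besselSeries (hp0 : 0 < p) (hp1 : p < 1) (hb0 : 0 < b)
    (hb : ∀ k : ℕ, b * p ^ k ≠ 1) (z : ℝ) :
    ContinuousOn (fun y => besselSeries p b y z) (Set.Icc (-1) 1) := by
  refine continuousOn_tsum (fun k => ?_) (summable_besselSeries_bound hp0 hp1 hb0 hb z)
    fun k y hy => abs_besselSeries_term_le hp0 hp1 z (abs_le.2 hy) k
  exact (continuous_const.mul (continuous_finsetProd _ fun i _ => by fun_prop)).continuousOn

lemma tendsto_besselSeries_zero (hp0 : 0 < p) (hp1 : p < 1) (hb0 : 0 < b)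
    (hb : ∀ k : ℕ, b * p ^ k ≠ 1) (z : ℝ) {u : ℕ → ℝ} (hu : Tendsto u atTop (𝓝 0)) :
    Tendsto (fun n => besselSeries p b (u n) z) atTop (𝓝 (besselSeries p b 0 z)) :=
  (((continuousOn_besselSeries hp0 hp1 hb0 hb z).continuousAt
    (Icc_mem_nhds (by norm_num) (by norm_num))).tendsto).comp hu

lemma shiftPoly_neg_one (k : ℕ) : shiftPoly p (k + 1) (-1) = 0 :=
  Finset.prod_eq_zero (Finset.mem_range.2 k.succ_pos) (by simp)

lemma shiftPoly_succ (k : ℕ) (y : ℝ) : shiftPoly p (k + 1) y = shiftPoly p k y * (y + p ^ k) :=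
  Finset.prod_range_succ _ _

lemma shiftPoly_mul_left (k : ℕ) (t : ℝ) :
    shiftPoly p (k + 1) (p * t) = p ^ k * (1 + p * t) * shiftPoly p k t := by
  simp only [shiftPoly, Finset.prod_range_succ']
  rw [Finset.prod_congr rfl (g := fun i => p * (t + p ^ i)) (fun i _ => by ring),
    Finset.prod_mul_distrib]
  simp
  ring

lemma shiftPoly_sub (k : ℕ) (y : ℝ) :
    shiftPoly p (k + 1) y - shiftPoly p (k + 1) (p * y)
      = (1 - p ^ (k + 1)) * y * shiftPoly p k y := by
  have h := shiftPoly_mul_left (p := p) k y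
  rw [h, shiftPoly_succ]
  ring

lemma besselSeries_neg_one (z : ℝ) : besselSeries p b (-1) z = 1 := by
  rw [besselSeries, tsum_eq_single 0]
  · simp [besselCoeff_zero, shiftPoly]
  · rintro (_ | k) hk
    · exact absurd rfl hk
    · simp [shiftPoly_neg_one]

/-- The lowering formula: the `p`-difference of the function with parameter `b` is the function
with parameter `b p`. -/
lemma besselSeries_sub (hp0 : 0 < p) (hp1 : p < 1) (hb0 : 0 < b)
    (hb : ∀ k : ℕ, b * p ^ k ≠ 1) (z : ℝ) {y : ℝ} (hy : |y| ≤ 1) :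
    besselSeries p b y z - besselSeries p b (p * y) z
      = -(b / (1 - b)) * z * y * besselSeries p (b * p) y z := by
  have hbp : ∀ k : ℕ, b * p * p ^ k ≠ 1 := fun k => by
    have := hb (k + 1); rwa [pow_succ', ← mul_assoc] at this
  have hpy : |p * y| ≤ 1 := by
    rw [abs_mul, abs_of_pos hp0]; exact mul_le_one₀ hp1.le (abs_nonneg _) hy
  have h1 := (hasSum_besselSeries hp0 hp1 hb0 hb z hy).sub (hasSum_besselSeries hp0 hp1 hb0 hb z hpy)
  have h2 := (hasSum_besselSeries hp0 hp1 (mul_pos hb0 hp0) hbp z hy).mul_left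
    (-(b / (1 - b)) * z * y)
  rw [← hasSum_nat_add_iff' 1] at h1
  simp only [Finset.range_one, Finset.sum_singleton, pow_zero, shiftPoly, Finset.range_zero,
    Finset.prod_empty, sub_self, sub_zero] at h1
  refine h1.unique (h2.congr_fun fun k => ?_)
  change besselCoeff p b (k + 1) * z ^ (k + 1) * shiftPoly p (k + 1) y
    - besselCoeff p b (k + 1) * z ^ (k + 1) * shiftPoly p (k + 1) (p * y) = _
  rw [← mul_sub, shiftPoly_sub]
  linear_combination ((z ^ (k + 1) * y * shiftPoly p k y)) * besselCoeff_succ_mul (b := b) hp0 hp1 k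

/-- The raising formula, a first-order relation from parameter `b p` back to parameter `b`. -/
lemma besselSeries_raise (hp0 : 0 < p) (hp1 : p < 1) (hb0 : 0 < b)
    (hb : ∀ k : ℕ, b * p ^ k ≠ 1) (z : ℝ) {t : ℝ} (ht : |t| ≤ 1) :
    (1 + p * t) * besselSeries p (b * p) t z - (1 + b * p * t) * besselSeries p (b * p) (p * t) z
      = (1 - b) * p * t * besselSeries p b (p * t) z := by
  have hbp : ∀ k : ℕ, b * p * p ^ k ≠ 1 := fun k => by
    have := hb (k + 1); rwa [pow_succ', ← mul_assoc] at this
  have hpt : |p * t| ≤ 1 := by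
    rw [abs_mul, abs_of_pos hp0]; exact mul_le_one₀ hp1.le (abs_nonneg _) ht
  have h1 := ((hasSum_besselSeries hp0 hp1 (mul_pos hb0 hp0) hbp z ht).mul_left (1 + p * t)).sub
    ((hasSum_besselSeries hp0 hp1 (mul_pos hb0 hp0) hbp z hpt).mul_left (1 + b * p * t))
  have h2 := (hasSum_besselSeries hp0 hp1 hb0 hb z hpt).mul_left ((1 - b) * p * t)
  refine h1.unique (h2.congr_fun fun k => ?_)
  have h3 : p ^ k * ((1 + p * t) * shiftPoly p k t)
      = shiftPoly p k (p * t) * (p * t + p ^ k) := by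
    rw [← shiftPoly_succ, shiftPoly_mul_left]; ring
  have h4 := besselCoeff_mul_one_sub hb k
  have h5 : p ^ k ≠ 0 := pow_ne_zero _ hp0.ne'
  apply mul_left_cancel₀ h5
  linear_combination (besselCoeff p (b * p) k * z ^ k) * h3
    + (p * t * z ^ k * shiftPoly p k (p * t)) * h4

/-- For `z < 0` every term of the series is nonnegative at the lattice points `±p^n`. -/
lemma besselSeries_pos (hp0 : 0 < p) (hp1 : p < 1) (hb0 : 0 < b) (hb1 : b < 1) {z : ℝ}
    (hz : z ≤ 0) {y : ℝ} (hy : ∃ n : ℕ, y = p ^ n ∨ y = -p ^ n) :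
    0 < besselSeries p b y z := by
  have hy1 : |y| ≤ 1 := by
    obtain ⟨n, rfl | rfl⟩ := hy <;>
    simpa [abs_of_pos hp0] using pow_le_one₀ (n := n) hp0.le hp1.le
  have hs := hasSum_besselSeries hp0 hp1 hb0 (mul_pow_ne_one hp0 hp1 hb1) z hy1
  have hq : ∀ a : ℝ, a < 1 → ∀ k, 0 ≤ qShifted a p k := fun a ha k =>
    Finset.prod_nonneg fun i _ => by
      have h1 : p ^ i ≤ 1 := pow_le_one₀ hp0.le hp1.le
      have h2 : 0 < p ^ i := pow_pos hp0 i
      nlinarith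
  have hφ : ∀ k, 0 ≤ shiftPoly p k y := by
    intro k
    obtain ⟨n, rfl | rfl⟩ := hy
    · exact Finset.prod_nonneg fun i _ => by positivity
    · rcases le_or_gt k n with hkn | hkn
      · refine Finset.prod_nonneg fun i hi => ?_
        have := pow_le_pow_of_le_one hp0.le hp1.le
          (show i ≤ n from ((Finset.mem_range.1 hi).trans_le hkn).le)
        linarith
      · exact (Finset.prod_eq_zero (Finset.mem_range.2 hkn) (by simp)).ge
  have hnn : ∀ k, 0 ≤ besselCoeff p b k * z ^ k * shiftPoly p k y := by
    intro k
    refine mul_nonneg ?_ (hφ k)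
    rw [besselCoeff, div_mul_eq_mul_div, mul_right_comm, ← mul_pow]
    refine div_nonneg (mul_nonneg (pow_nonneg ?_ k) (pow_nonneg hp0.le _))
      (mul_nonneg (hq p hp1 k) (hq b hb1 k))
    nlinarith
  have h0 : (1 : ℝ) ≤ besselSeries p b y z := by
    have := le_hasSum hs 0 fun k _ => hnn k
    simpa [besselCoeff_zero, shiftPoly] using this
  linarith

end series

/-! ### Infinite shifted factorials and the weight -/

section weight

variable {p b : ℝ}

lemma multipliable_qShiftedInf (hp0 : 0 < p) (hp1 : p < 1) (a : ℝ) :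
    Multipliable fun i : ℕ => 1 - a * p ^ i := by
  have := Real.multipliable_one_add_of_summable
    ((summable_geometric_of_lt_one hp0.le hp1).mul_left (-a))
  simpa [sub_eq_add_neg] using this

lemma qShiftedInf_eq_mul (hp0 : 0 < p) (hp1 : p < 1) (a : ℝ) :
    qShiftedInf a p = (1 - a) * qShiftedInf (a * p) p := by
  have h := multipliable_qShiftedInf hp0 hp1 (a * p)
  have h' : (fun i : ℕ => 1 - a * p * p ^ i) = fun i : ℕ => 1 - a * p ^ (i + 1) := by
    ext i; rw [pow_succ']; ring
  rw [h'] at h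
  have h2 := tprod_eq_zero_mul' (f := fun i : ℕ => 1 - a * p ^ i) h
  rw [qShiftedInf, qShiftedInf, h', h2, pow_zero, mul_one]

lemma qShiftedInf_pos (hp0 : 0 < p) (hp1 : p < 1) {a : ℝ} (ha : a < 1) :
    0 < qShiftedInf a p := by
  have hpos : ∀ i : ℕ, 0 < 1 - a * p ^ i := fun i => by
    have h1 : p ^ i ≤ 1 := pow_le_one₀ hp0.le hp1.le
    have h2 : 0 < p ^ i := pow_pos hp0 i
    nlinarith
  have hne : ∏' i : ℕ, (1 + -a * p ^ i) ≠ 0 := by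
    refine tprod_one_add_ne_zero_of_summable (fun i => ?_) ?_
    · have := hpos i
      rw [neg_mul, ← sub_eq_add_neg]
      exact this.ne'
    · exact ((summable_geometric_of_lt_one hp0.le hp1).mul_left (-a)).norm
  simp only [neg_mul, ← sub_eq_add_neg] at hne
  refine lt_of_le_of_ne ?_ hne.symm
  exact ge_of_tendsto' (multipliable_qShiftedInf hp0 hp1 a).hasProd.tendsto_prod_nat
    fun n => Finset.prod_nonneg fun i _ => (hpos i).le

lemma qShiftedInf_eq_qShifted_mul (hp0 : 0 < p) (hp1 : p < 1) (a : ℝ) (n : ℕ) :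
    qShiftedInf a p = qShifted a p n * qShiftedInf (a * p ^ n) p := by
  induction n with
  | zero => simp [qShifted]
  | succ n ih =>
    rw [ih, qShiftedInf_eq_mul hp0 hp1 (a * p ^ n), qShifted_succ, pow_succ]
    ring_nf

lemma tendsto_qShiftedInf_mul_pow (hp0 : 0 < p) (hp1 : p < 1) {a : ℝ} (ha : a < 1) :
    Tendsto (fun n : ℕ => qShiftedInf (a * p ^ n) p) atTop (𝓝 1) := by
  have hP := (qShiftedInf_pos hp0 hp1 ha).ne'
  have h1 : Tendsto (fun n => qShifted a p n) atTop (𝓝 (qShiftedInf a p)) :=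
    (multipliable_qShiftedInf hp0 hp1 a).hasProd.tendsto_prod_nat
  have h2 := (tendsto_const_nhds (x := qShiftedInf a p)).div h1 hP
  rw [div_self hP] at h2
  refine h2.congr fun n => ?_
  rw [Pi.div_apply, qShiftedInf_eq_qShifted_mul hp0 hp1 a n]
  refine mul_div_cancel_left₀ _ fun h0 => hP ?_
  rw [qShiftedInf_eq_qShifted_mul hp0 hp1 a n, h0, zero_mul]

/-- The weight `(-p y; p)_∞ / (-b p y; p)_∞`; with `p = q²`, `b = q^{2α+2}` the weight
`besselWeight q α x` is `x` times its value at `y = x²`. -/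
def latticeWeight (p b y : ℝ) : ℝ :=
  qShiftedInf (-(p * y)) p / qShiftedInf (-(b * p * y)) p

lemma mul_lt_one_of_abs_le {c y : ℝ} (hc0 : 0 < c) (hc1 : c < 1) (hy : |y| ≤ 1) : -(c * y) < 1 := by
  nlinarith [(abs_le.1 hy).1]

lemma latticeWeight_pos (hp0 : 0 < p) (hp1 : p < 1) (hb0 : 0 < b) (hbp : b * p < 1) {y : ℝ}
    (hy : |y| ≤ 1) : 0 < latticeWeight p b y :=
  div_pos (qShiftedInf_pos hp0 hp1 (mul_lt_one_of_abs_le hp0 hp1 hy))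
    (qShiftedInf_pos hp0 hp1 (mul_lt_one_of_abs_le (mul_pos hb0 hp0) hbp hy))

lemma latticeWeight_mul (hp0 : 0 < p) (hp1 : p < 1) (hb0 : 0 < b) (hbp : b * p < 1) {t : ℝ}
    (ht : |t| ≤ 1) :
    latticeWeight p b t * (1 + b * p * t) = latticeWeight p b (p * t) * (1 + p * t) := by
  have hpt : |p * t| ≤ 1 := by
    rw [abs_mul, abs_of_pos hp0]; exact mul_le_one₀ hp1.le (abs_nonneg _) ht
  have h1 := mul_lt_one_of_abs_le (mul_pos hb0 hp0) hbp ht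
  have h2 := (qShiftedInf_pos hp0 hp1 (mul_lt_one_of_abs_le (mul_pos hb0 hp0) hbp hpt)).ne'
  have h3 : 1 + b * p * t ≠ 0 := by linarith
  rw [latticeWeight, latticeWeight, qShiftedInf_eq_mul hp0 hp1 (-(p * t)),
    qShiftedInf_eq_mul hp0 hp1 (-(b * p * t)),
    show -(p * t) * p = -(p * (p * t)) by ring, show -(b * p * t) * p = -(b * p * (p * t)) by ring,
    sub_neg_eq_add, sub_neg_eq_add, div_mul_eq_mul_div, div_mul_eq_mul_div,
    div_eq_div_iff (mul_ne_zero h3 h2) h2]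
  ring

lemma tendsto_latticeWeight (hp0 : 0 < p) (hp1 : p < 1) (hb0 : 0 < b) (hbp : b * p < 1) {t : ℝ}
    (ht : |t| ≤ 1) : Tendsto (fun n : ℕ => latticeWeight p b (t * p ^ n)) atTop (𝓝 1) := by
  have h1 := tendsto_qShiftedInf_mul_pow hp0 hp1 (mul_lt_one_of_abs_le hp0 hp1 ht)
  have h2 := tendsto_qShiftedInf_mul_pow hp0 hp1 (mul_lt_one_of_abs_le (mul_pos hb0 hp0) hbp ht)
  have h3 := h1.div h2 one_ne_zero
  rw [div_one] at h3
  refine h3.congr fun n => ?_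
  rw [Pi.div_apply, latticeWeight]
  congr 2 <;> ring

end weight

/-! ### The two-sided lattice -/

/-- The lattice `{p^n} ∪ {-p^n}`: the left copy of `ℕ` indexes the points `p^n`, the right copy
the points `-p^n`. -/
def latticePt (p : ℝ) : ℕ ⊕ ℕ → ℝ :=
  Sum.elim (fun n => p ^ n) (fun n => -p ^ n)

section lattice

variable {p b : ℝ}

@[simp] lemma latticePt_inl (n : ℕ) : latticePt p (.inl n) = p ^ n := rfl

@[simp] lemma latticePt_inr (n : ℕ) : latticePt p (.inr n) = -p ^ n := rfl

lemma abs_latticePt (hp0 : 0 < p) (i : ℕ ⊕ ℕ) : |latticePt p i| = p ^ (i.elim id id) := by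
  rcases i with n | n <;> simp [abs_of_pos hp0]

lemma abs_latticePt_le_one (hp0 : 0 < p) (hp1 : p < 1) (i : ℕ ⊕ ℕ) : |latticePt p i| ≤ 1 := by
  rw [abs_latticePt hp0]
  exact pow_le_one₀ hp0.le hp1.le

lemma abs_latticePt_pos (hp0 : 0 < p) (i : ℕ ⊕ ℕ) : 0 < |latticePt p i| := by
  rw [abs_latticePt hp0]
  exact pow_pos hp0 _

/-- A function on the lattice with a limit at `0` along each half is bounded. -/
lemma exists_abs_le_of_tendsto {f : ℕ ⊕ ℕ → ℝ} {l l' : ℝ}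
    (hl : Tendsto (fun n => f (.inl n)) atTop (𝓝 l))
    (hr : Tendsto (fun n => f (.inr n)) atTop (𝓝 l')) : ∃ C, 0 ≤ C ∧ ∀ i, |f i| ≤ C := by
  obtain ⟨A, hA⟩ := hl.abs.bddAbove_range
  obtain ⟨B, hB⟩ := hr.abs.bddAbove_range
  refine ⟨max A B, ?_, ?_⟩
  · exact ((abs_nonneg _).trans (hA ⟨0, rfl⟩)).trans (le_max_left _ _)
  · rintro (n | n)
    · exact (hA ⟨n, rfl⟩).trans (le_max_left _ _)
    · exact (hB ⟨n, rfl⟩).trans (le_max_right _ _)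

lemma summable_abs_latticePt (hp0 : 0 < p) (hp1 : p < 1) :
    Summable fun i : ℕ ⊕ ℕ => |latticePt p i| := by
  have h := (summable_geometric_of_lt_one hp0.le hp1).hasSum
  refine (HasSum.sum (f := fun i => |latticePt p i|) (a := ∑' n : ℕ, p ^ n) (b := ∑' n : ℕ, p ^ n)
    ?_ ?_).summable
  · refine h.congr_fun fun n => ?_
    simp [abs_of_pos hp0]
  · refine h.congr_fun fun n => ?_
    simp [abs_of_pos hp0]

lemma summable_abs_latticePt_mul (hp0 : 0 < p) (hp1 : p < 1) {f : ℕ ⊕ ℕ → ℝ} {C : ℝ}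
    (hf : ∀ i, |f i| ≤ C) : Summable fun i => |latticePt p i| * f i := by
  refine Summable.of_norm_bounded ((summable_abs_latticePt hp0 hp1).mul_right C) fun i => ?_
  rw [Real.norm_eq_abs, abs_mul, abs_abs]
  exact mul_le_mul_of_nonneg_left (hf i) (abs_nonneg _)

lemma tendsto_weight_inl (hp0 : 0 < p) (hp1 : p < 1) (hb0 : 0 < b) (hbp : b * p < 1) :
    Tendsto (fun n : ℕ => latticeWeight p b (latticePt p (.inl n))) atTop (𝓝 1) := by
  simpa using tendsto_latticeWeight hp0 hp1 hb0 hbp (t := 1) (by simp)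

lemma tendsto_weight_inr (hp0 : 0 < p) (hp1 : p < 1) (hb0 : 0 < b) (hbp : b * p < 1) :
    Tendsto (fun n : ℕ => latticeWeight p b (latticePt p (.inr n))) atTop (𝓝 1) := by
  simpa using tendsto_latticeWeight hp0 hp1 hb0 hbp (t := -1) (by simp)

lemma exists_abs_latticeWeight_le (hp0 : 0 < p) (hp1 : p < 1) (hb0 : 0 < b) (hbp : b * p < 1) :
    ∃ C, 0 ≤ C ∧ ∀ i, |latticeWeight p b (latticePt p i)| ≤ C :=
  exists_abs_le_of_tendsto (tendsto_weight_inl hp0 hp1 hb0 hbp) (tendsto_weight_inr hp0 hp1 hb0 hbp)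

lemma exists_abs_inv_latticeWeight_le (hp0 : 0 < p) (hp1 : p < 1) (hb0 : 0 < b)
    (hbp : b * p < 1) :
    ∃ C, 0 ≤ C ∧ ∀ i, |(latticeWeight p b (latticePt p i))⁻¹| ≤ C :=
  exists_abs_le_of_tendsto (f := fun i => (latticeWeight p b (latticePt p i))⁻¹)
    ((tendsto_weight_inl hp0 hp1 hb0 hbp).inv₀ one_ne_zero)
    ((tendsto_weight_inr hp0 hp1 hb0 hbp).inv₀ one_ne_zero)

/-- The weight of the companion function with parameter `b`, relative to `|y|`. On the
lattice it is negative at `y = -1` when `b > 1`, and positive otherwise. -/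
def companionWeight (p b y : ℝ) : ℝ :=
  latticeWeight p b y / (1 + b * y)

lemma one_add_mul_latticePt_ne_zero (hp0 : 0 < p) (hb0 : 0 < b) (hb : ∀ k : ℕ, b * p ^ k ≠ 1)
    (i : ℕ ⊕ ℕ) : 1 + b * latticePt p i ≠ 0 := by
  rcases i with n | n
  · rw [latticePt_inl]; positivity
  · rw [latticePt_inr, mul_neg, ← sub_eq_add_neg]
    exact sub_ne_zero.2 (hb n).symm

lemma companionWeight_ne_zero (hp0 : 0 < p) (hp1 : p < 1) (hb0 : 0 < b) (hbp : b * p < 1)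
    (hb : ∀ k : ℕ, b * p ^ k ≠ 1) (i : ℕ ⊕ ℕ) : companionWeight p b (latticePt p i) ≠ 0 :=
  div_ne_zero (latticeWeight_pos hp0 hp1 hb0 hbp (abs_latticePt_le_one hp0 hp1 i)).ne'
    (one_add_mul_latticePt_ne_zero hp0 hb0 hb i)

lemma exists_abs_companionWeight_le (hp0 : 0 < p) (hp1 : p < 1) (hb0 : 0 < b) (hbp : b * p < 1) :
    ∃ C, 0 ≤ C ∧ ∀ i, |companionWeight p b (latticePt p i)| ≤ C := by
  have hpk : Tendsto (fun k : ℕ => p ^ k) atTop (𝓝 0) :=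
    tendsto_pow_atTop_nhds_zero_of_lt_one hp0.le hp1
  refine exists_abs_le_of_tendsto (f := fun i => companionWeight p b (latticePt p i))
    (l := 1 / (1 + b * 0)) (l' := 1 / (1 + b * -0)) ?_ ?_
  · exact (tendsto_weight_inl hp0 hp1 hb0 hbp).div ((hpk.const_mul b).const_add 1) (by simp)
  · exact (tendsto_weight_inr hp0 hp1 hb0 hbp).div ((hpk.neg.const_mul b).const_add 1) (by simp)

end lattice

/-! ### Compact symmetric operators as sums of rank-one operators -/

/-- The real Hilbert space `ℓ²(ι)`. -/
abbrev RealL2 (ι : Type) : Type := lp (fun _ : ι => ℝ) 2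

section operator

variable {ι : Type}

lemma memlp_two_of_summable_sq {f : ι → ℝ} (hf : Summable fun i => f i ^ 2) : Memℓp f 2 := by
  refine memℓp_gen (hf.congr fun i => ?_)
  simp

lemma realL2_hasSum_inner (f g : RealL2 ι) : HasSum (fun i => f i * g i) (inner ℝ f g) := by
  refine (lp.hasSum_inner f g).congr_fun fun i => ?_
  simp [mul_comm]

/-- Data of an integral operator `Aᵗ δ A` on `ℓ²(ι)`: a bounded kernel `A`, a square-summable `s`
(the kernel acts as `A k i * s i`) and an absolutely summable, possibly indefinite, diagonal `δ`. -/
structure KernelData (ι : Type) where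
  /-- the kernel -/
  A : ι → ι → ℝ
  /-- the square-summable factor -/
  s : ι → ℝ
  /-- the diagonal -/
  d : ι → ℝ
  abs_A_le : ∀ k i, |A k i| ≤ 1
  summable_s : Summable fun i => s i ^ 2
  summable_d : Summable fun i => |d i|

namespace KernelData

variable (K : KernelData ι)

/-- The `k`-th row `A k · * s` as a vector of `ℓ²`. -/
def row (k : ι) : RealL2 ι :=
  ⟨fun i => K.A k i * K.s i, memlp_two_of_summable_sq <| by
    refine Summable.of_nonneg_of_le (fun i => sq_nonneg _) (fun i => ?_) K.summable_s
    rw [mul_pow]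
    refine mul_le_of_le_one_left (sq_nonneg _) ?_
    rw [← sq_abs]
    exact pow_le_one₀ (abs_nonneg _) (K.abs_A_le k i)⟩

lemma row_apply (k i : ι) : K.row k i = K.A k i * K.s i := rfl

lemma norm_row_sq_le (k : ι) : ‖K.row k‖ ^ 2 ≤ ∑' i, K.s i ^ 2 := by
  rw [← real_inner_self_eq_norm_sq]
  refine hasSum_le (fun i => ?_) (realL2_hasSum_inner (K.row k) (K.row k)) K.summable_s.hasSum
  rw [row_apply, ← sq, mul_pow]
  refine mul_le_of_le_one_left (sq_nonneg _) ?_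
  rw [← sq_abs]
  exact pow_le_one₀ (abs_nonneg _) (K.abs_A_le k i)

lemma hasSum_inner_row (k : ι) (ψ : RealL2 ι) :
    HasSum (fun i => K.A k i * (K.s i * ψ i)) (inner ℝ (K.row k) ψ) := by
  refine (realL2_hasSum_inner (K.row k) ψ).congr_fun fun i => ?_
  rw [row_apply, mul_assoc]

lemma abs_inner_row_le (ψ : RealL2 ι) :
    ∃ C, ∀ k, |inner ℝ (K.row k) ψ| ≤ C := by
  refine ⟨√(∑' i, K.s i ^ 2) * ‖ψ‖, fun k => (abs_real_inner_le_norm _ _).trans ?_⟩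
  exact mul_le_mul_of_nonneg_right (Real.le_sqrt_of_sq_le (K.norm_row_sq_le k)) (norm_nonneg _)

lemma summable_rankOne :
    Summable fun k => K.d k • InnerProductSpace.rankOne ℝ (K.row k) (K.row k) := by
  refine Summable.of_norm_bounded (K.summable_d.mul_right (∑' i, K.s i ^ 2)) fun k => ?_
  rw [norm_smul, InnerProductSpace.norm_rankOne, ← sq, Real.norm_eq_abs]
  exact mul_le_mul_of_nonneg_left (K.norm_row_sq_le k) (abs_nonneg _)

/-- The operator `∑ k, d k ⟪row k, ·⟫ row k`. -/
def op : RealL2 ι →L[ℝ] RealL2 ι :=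
  ∑' k, K.d k • InnerProductSpace.rankOne ℝ (K.row k) (K.row k)

lemma isCompactOperator_op : IsCompactOperator K.op := by
  refine isCompactOperator_of_tendsto K.summable_rankOne.hasSum (Eventually.of_forall fun t => ?_)
  change (∑ k ∈ t, K.d k • InnerProductSpace.rankOne ℝ (K.row k) (K.row k))
    ∈ compactOperator (RingHom.id ℝ) (RealL2 ι) (RealL2 ι)
  refine Submodule.sum_mem _ fun k _ => Submodule.smul_mem _ _ ?_
  change IsCompactOperator (InnerProductSpace.rankOne ℝ (K.row k) (K.row k))
  rw [InnerProductSpace.rankOne_def']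
  have h : IsCompactOperator (ContinuousLinearMap.toSpanSingleton ℝ (K.row k)) :=
    isCompactOperator_of_locallyCompactSpace_rng _
  exact h.comp_clm (innerSL ℝ (K.row k))

lemma hasSum_op (ψ : RealL2 ι) :
    HasSum (fun k => (K.d k * inner ℝ (K.row k) ψ) • K.row k) (K.op ψ) := by
  refine ((ContinuousLinearMap.apply ℝ (RealL2 ι) ψ).hasSum
    K.summable_rankOne.hasSum).congr_fun fun k => ?_
  simp [mul_smul]

lemma isSymmetric_op : K.op.IsSymmetric := by
  intro φ ψ
  have h1 := (innerSL ℝ ψ).hasSum (K.hasSum_op φ)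
  have h2 := (innerSL ℝ φ).hasSum (K.hasSum_op ψ)
  change inner ℝ (K.op φ) ψ = inner ℝ φ (K.op ψ)
  rw [real_inner_comm]
  refine h1.unique (h2.congr_fun fun k => ?_)
  simp only [innerSL_apply_apply, inner_smul_right, real_inner_comm]
  ring

lemma hasSum_op_apply (ψ : RealL2 ι) (i : ι) :
    HasSum (fun k => K.A k i * (K.d k * inner ℝ (K.row k) ψ) * K.s i) (K.op ψ i) := by
  refine ((lp.evalCLM ℝ (fun _ : ι => ℝ) 2 i).hasSum (K.hasSum_op ψ)).congr_fun fun k => ?_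
  change _ = (K.d k * inner ℝ (K.row k) ψ) * K.row k i
  rw [row_apply]
  ring

end KernelData

end operator

/-! ### The first-order system on the lattice -/

/-- The discrete first-order system satisfied on the two-sided lattice by an eigenvector with
eigenvalue `τ`: `X` is the companion function (parameter `b`) and `Y` the weighted function
(parameter `b p`). The boundary condition at `y = 1` is not part of it. -/
structure LatticeSystem (σ d : ℕ ⊕ ℕ → ℝ) (τ : ℝ) (X Y : ℕ ⊕ ℕ → ℝ) : Prop where
  X_inl : ∀ n, X (.inl (n + 1)) - X (.inl n) = σ (.inl n) * Y (.inl n)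
  X_inr : ∀ n, X (.inr n) - X (.inr (n + 1)) = σ (.inr n) * Y (.inr n)
  X_lim : Tendsto (fun n => X (.inl n) - X (.inr n)) atTop (𝓝 0)
  Y_zero : τ * Y (.inr 0) = d (.inr 0) * X (.inr 0)
  Y_inr : ∀ n, τ * (Y (.inr (n + 1)) - Y (.inr n)) = d (.inr (n + 1)) * X (.inr (n + 1))
  Y_inl : ∀ n, τ * (Y (.inl n) - Y (.inl (n + 1))) = d (.inl (n + 1)) * X (.inl (n + 1))
  Y_lim : Tendsto (fun n => τ * (Y (.inl n) - Y (.inr n))) atTop (𝓝 0)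

namespace LatticeSystem

variable {σ d : ℕ ⊕ ℕ → ℝ} {τ : ℝ} {X Y X' Y' : ℕ ⊕ ℕ → ℝ}

lemma sub_smul (h : LatticeSystem σ d τ X Y) (h' : LatticeSystem σ d τ X' Y') (c : ℝ) :
    LatticeSystem σ d τ (fun i => X i - c * X' i) (fun i => Y i - c * Y' i) where
  X_inl n := by linear_combination h.X_inl n - c * h'.X_inl n
  X_inr n := by linear_combination h.X_inr n - c * h'.X_inr n
  X_lim := by
    have := h.X_lim.sub (h'.X_lim.const_mul c)
    rw [mul_zero, sub_zero] at this
    exact this.congr fun n => by ring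
  Y_zero := by linear_combination h.Y_zero - c * h'.Y_zero
  Y_inr n := by linear_combination h.Y_inr n - c * h'.Y_inr n
  Y_inl n := by linear_combination h.Y_inl n - c * h'.Y_inl n
  Y_lim := by
    have := h.Y_lim.sub (h'.Y_lim.const_mul c)
    rw [mul_zero, sub_zero] at this
    exact this.congr fun n => by ring

/-- A solution with `Y = 0` at `y = -1` vanishes on the negative half of the lattice. -/
lemma eq_zero_inr (h : LatticeSystem σ d τ X Y) (hτ : τ ≠ 0) (hd : d (.inr 0) ≠ 0)
    (h0 : Y (.inr 0) = 0) (n : ℕ) : X (.inr n) = 0 ∧ Y (.inr n) = 0 := by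
  induction n with
  | zero =>
    have h1 := h.Y_zero
    rw [h0, mul_zero] at h1
    exact ⟨(mul_eq_zero.1 h1.symm).resolve_left hd, h0⟩
  | succ n ih =>
    have hX : X (.inr (n + 1)) = 0 := by
      have h1 := h.X_inr n
      rw [ih.1, ih.2, mul_zero] at h1
      linarith
    refine ⟨hX, ?_⟩
    have h1 := h.Y_inr n
    rw [hX, ih.2, mul_zero, sub_zero] at h1
    exact (mul_eq_zero.1 h1).resolve_left hτ

end LatticeSystem

/-- Discrete Gronwall: `E n ≤ (1 + C p^n) E (n+1)` and `E → 0` force `E = 0`. -/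
lemma eq_zero_of_le_one_add_mul {p C : ℝ} (hp0 : 0 < p) (hp1 : p < 1) (hC : 0 ≤ C) {E : ℕ → ℝ}
    (hE0 : ∀ n, 0 ≤ E n) (hE : ∀ n, E n ≤ (1 + C * p ^ n) * E (n + 1))
    (hlim : Tendsto E atTop (𝓝 0)) (n : ℕ) : E n = 0 := by
  have hbound : ∀ m, E n ≤ Real.exp (∑ j ∈ Finset.range m, C * p ^ j) * E (n + m) := by
    intro m
    induction m with
    | zero => simp
    | succ m ih =>
      refine ih.trans ?_
      rw [Finset.sum_range_succ, Real.exp_add, mul_assoc]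
      refine mul_le_mul_of_nonneg_left ((hE (n + m)).trans ?_) (Real.exp_pos _).le
      refine mul_le_mul_of_nonneg_right ?_ (hE0 _)
      have h1 : p ^ (n + m) ≤ p ^ m := pow_le_pow_of_le_one hp0.le hp1.le (by omega)
      have h2 := Real.add_one_le_exp (C * p ^ m)
      have h3 := mul_le_mul_of_nonneg_left h1 hC
      linarith
  have hS : Summable fun j : ℕ => C * p ^ j :=
    (summable_geometric_of_lt_one hp0.le hp1).mul_left C
  have hle : ∀ m, E n ≤ Real.exp (∑' j : ℕ, C * p ^ j) * E (m + n) := fun m => by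
    rw [add_comm m n]
    refine (hbound m).trans (mul_le_mul_of_nonneg_right (Real.exp_le_exp.2 ?_) (hE0 _))
    exact hS.sum_le_tsum _ fun j _ => mul_nonneg hC (pow_nonneg hp0.le j)
  have h0 := ge_of_tendsto' (((tendsto_add_atTop_iff_nat n).2 hlim).const_mul
    (Real.exp (∑' j : ℕ, C * p ^ j))) hle
  rw [mul_zero] at h0
  exact le_antisymm h0 (hE0 n)

namespace LatticeSystem

variable {σ d : ℕ ⊕ ℕ → ℝ} {τ : ℝ} {X Y X' Y' : ℕ ⊕ ℕ → ℝ}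

/-- Uniqueness for the system: the value of `Y` at `y = -1` determines the solution. It is carried
along the negative half and across `y = 0` by continuity, where a Gronwall estimate applies. -/
lemma eq_zero (h : LatticeSystem σ d τ X Y) (hτ : τ ≠ 0) (hd : d (.inr 0) ≠ 0) {p C : ℝ}
    (hp0 : 0 < p) (hp1 : p < 1) (hC : 0 ≤ C) (hσC : ∀ n, |σ (.inl n)| ≤ C * p ^ n)
    (hdC : ∀ n, |d (.inl n)| ≤ C * p ^ n) (h0 : Y (.inr 0) = 0) (i : ℕ ⊕ ℕ) :
    X i = 0 ∧ Y i = 0 := by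
  rcases i with n | n
  swap
  · exact h.eq_zero_inr hτ hd h0 n
  have hX : Tendsto (fun n => X (.inl n)) atTop (𝓝 0) :=
    h.X_lim.congr fun n => by rw [(h.eq_zero_inr hτ hd h0 n).1, sub_zero]
  have hY : Tendsto (fun n => Y (.inl n)) atTop (𝓝 0) := by
    have := h.Y_lim.const_mul τ⁻¹
    rw [mul_zero] at this
    refine this.congr fun n => ?_
    rw [(h.eq_zero_inr hτ hd h0 n).2, sub_zero, inv_mul_cancel_left₀ hτ]
  set D : ℝ := C / |τ| with hD
  have hD0 : 0 ≤ D := div_nonneg hC (abs_nonneg _)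
  -- one step of the recursion, from `n + 1` down to `n`
  have hYstep : ∀ n, |Y (.inl n)| ≤ |Y (.inl (n + 1))| + D * p ^ n * |X (.inl (n + 1))| := by
    intro n
    have h1 : Y (.inl n) = Y (.inl (n + 1)) + d (.inl (n + 1)) / τ * X (.inl (n + 1)) := by
      have := h.Y_inl n
      field_simp
      linarith
    rw [h1]
    refine (abs_add_le _ _).trans (add_le_add_right ?_ _)
    rw [abs_mul, abs_div, hD, div_mul_eq_mul_div C]
    refine mul_le_mul_of_nonneg_right (div_le_div_of_nonneg_right ?_ (abs_nonneg τ)) (abs_nonneg _)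
    refine (hdC (n + 1)).trans (mul_le_mul_of_nonneg_left ?_ hC)
    exact pow_le_pow_of_le_one hp0.le hp1.le (Nat.le_succ n)
  have hXstep : ∀ n, |X (.inl n)| ≤ |X (.inl (n + 1))| + C * p ^ n * |Y (.inl n)| := by
    intro n
    have h1 : X (.inl n) = X (.inl (n + 1)) - σ (.inl n) * Y (.inl n) := by
      linear_combination -h.X_inl n
    rw [h1]
    refine (abs_sub _ _).trans (add_le_add_right ?_ _)
    rw [abs_mul]
    exact mul_le_mul_of_nonneg_right (hσC n) (abs_nonneg _)
  have key := eq_zero_of_le_one_add_mul (E := fun n => |X (.inl n)| + |Y (.inl n)|)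
    (C := C + D + C * D) hp0 hp1 (by positivity)
    (fun n => by positivity) (fun n => ?_) (by simpa using hX.abs.add hY.abs) n
  · have h1 := abs_nonneg (X (.inl n))
    have h2 := abs_nonneg (Y (.inl n))
    constructor <;> apply abs_eq_zero.1 <;> linarith
  · have h1 := hXstep n
    have h2 := hYstep n
    have hpn : p ^ n ≤ 1 := pow_le_one₀ hp0.le hp1.le
    have hpn0 : 0 < p ^ n := pow_pos hp0 n
    have h3 := mul_le_mul_of_nonneg_left h2 (show 0 ≤ C * p ^ n by positivity)
    set x := |X (.inl (n + 1))| with hx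
    set y := |Y (.inl (n + 1))| with hy
    have hx0 : 0 ≤ x := abs_nonneg _
    have hy0 : 0 ≤ y := abs_nonneg _
    have h4 : C * p ^ n * (D * p ^ n * x) ≤ C * D * p ^ n * x := by
      have : C * D * p ^ n * x * p ^ n ≤ C * D * p ^ n * x :=
        mul_le_of_le_one_right (by positivity) hpn
      linarith
    have h5 : 0 ≤ C * D * p ^ n * y := by positivity
    have h6 : 0 ≤ C * p ^ n * x := by positivity
    have h7 : 0 ≤ D * p ^ n * y := by positivity
    change |X (.inl n)| + |Y (.inl n)| ≤ (1 + (C + D + C * D) * p ^ n) * (x + y)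
    nlinarith

end LatticeSystem

/-! ### The integral operator of the lattice -/

/-- The order relation of the lattice as a `0`-`1` kernel: the entry at `(k, i)` tells whether the
`i`-th point contributes to the `p`-integral from the `k`-th point up to `1`. Point `p^n` excludes
itself and `-p^n` includes itself, because the lowering formula relates `y` to `p y`. -/
def latticeKernel : ℕ ⊕ ℕ → ℕ ⊕ ℕ → ℝ
  | .inl n, .inl m => if m < n then 1 else 0
  | .inl _, .inr _ => 0
  | .inr _, .inl _ => 1
  | .inr n, .inr m => if n ≤ m then 1 else 0

lemma abs_latticeKernel_le (k i : ℕ ⊕ ℕ) : |latticeKernel k i| ≤ 1 := by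
  rcases k with n | n <;> rcases i with m | m <;> simp only [latticeKernel]
  · split_ifs <;> simp
  · simp
  · simp
  · split_ifs <;> simp

lemma latticeKernel_left_inl (n : ℕ) (i : ℕ ⊕ ℕ) :
    latticeKernel (.inl (n + 1)) i - latticeKernel (.inl n) i = if i = .inl n then 1 else 0 := by
  rcases i with m | m <;> simp only [latticeKernel, Sum.inl.injEq, reduceCtorEq]
  · split_ifs <;> first | omega | norm_num
  · simp

lemma latticeKernel_left_inr (n : ℕ) (i : ℕ ⊕ ℕ) :
    latticeKernel (.inr n) i - latticeKernel (.inr (n + 1)) i = if i = .inr n then 1 else 0 := by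
  rcases i with m | m <;> simp only [latticeKernel, Sum.inr.injEq, reduceCtorEq]
  · simp
  · split_ifs <;> first | omega | norm_num

lemma latticeKernel_right_inl (n : ℕ) (k : ℕ ⊕ ℕ) :
    latticeKernel k (.inl n) - latticeKernel k (.inl (n + 1))
      = if k = .inl (n + 1) then 1 else 0 := by
  rcases k with m | m <;> simp only [latticeKernel, Sum.inl.injEq, reduceCtorEq]
  · split_ifs <;> first | omega | norm_num
  · simp

lemma latticeKernel_right_inr (n : ℕ) (k : ℕ ⊕ ℕ) :
    latticeKernel k (.inr (n + 1)) - latticeKernel k (.inr n)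
      = if k = .inr (n + 1) then 1 else 0 := by
  rcases k with m | m <;> simp only [latticeKernel, Sum.inr.injEq, reduceCtorEq]
  · simp
  · split_ifs <;> first | omega | norm_num

lemma latticeKernel_right_zero (k : ℕ ⊕ ℕ) :
    latticeKernel k (.inr 0) = if k = .inr 0 then 1 else 0 := by
  rcases k with m | m <;> simp [latticeKernel]

lemma tendsto_latticeKernel_left (i : ℕ ⊕ ℕ) :
    Tendsto (fun n => latticeKernel (.inl n) i - latticeKernel (.inr n) i) atTop (𝓝 0) := by
  refine tendsto_const_nhds.congr' ?_
  rcases i with m | m <;> filter_upwards [eventually_gt_atTop m] with n hn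
  · simp [latticeKernel, hn]
  · simp [latticeKernel, hn]

lemma tendsto_latticeKernel_right (k : ℕ ⊕ ℕ) :
    Tendsto (fun n => latticeKernel k (.inl n) - latticeKernel k (.inr n)) atTop (𝓝 0) := by
  refine tendsto_const_nhds.congr' ?_
  rcases k with m | m <;> filter_upwards [eventually_gt_atTop m] with n hn
  · simp [latticeKernel, hn.le]
  · simp [latticeKernel, hn.le]

/-- A difference of two kernel sums picks out one term when the kernel difference is a delta. -/
lemma hasSum_sub_eq_of_delta {ι : Type} [DecidableEq ι] {a a' f : ι → ℝ} {S S' : ℝ} {j : ι}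
    (h : HasSum (fun i => a i * f i) S) (h' : HasSum (fun i => a' i * f i) S')
    (hd : ∀ i, a i - a' i = if i = j then 1 else 0) : S - S' = f j := by
  refine (h.sub h').unique ?_
  convert! hasSum_ite_eq j (f j) using 2 with i
  rw [← sub_mul, hd]
  split_ifs with hij
  · rw [hij, one_mul]
  · rw [zero_mul]

/-- Dominated convergence for kernel sums. -/
lemma tendsto_hasSum_sub {ι : Type} {a a' : ℕ → ι → ℝ} {f : ι → ℝ} {S S' : ℕ → ℝ}
    (hf : Summable fun i => |f i|) (ha : ∀ n i, |a n i| ≤ 1) (ha' : ∀ n i, |a' n i| ≤ 1)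
    (h : ∀ n, HasSum (fun i => a n i * f i) (S n)) (h' : ∀ n, HasSum (fun i => a' n i * f i) (S' n))
    (hlim : ∀ i, Tendsto (fun n => a n i - a' n i) atTop (𝓝 0)) :
    Tendsto (fun n => S n - S' n) atTop (𝓝 0) := by
  have h1 : ∀ n, S n - S' n = ∑' i, (a n i - a' n i) * f i := fun n => by
    refine (((h n).sub (h' n)).tsum_eq.symm).trans (tsum_congr fun i => by ring)
  simp only [h1]
  have h2 := tendsto_tsum_of_dominated_convergence (𝓕 := atTop)
    (f := fun n i => (a n i - a' n i) * f i) (g := fun _ => (0 : ℝ))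
    (bound := fun i => 2 * |f i|) (hf.mul_left 2) (fun i => by
      simpa using (hlim i).mul_const (f i)) (Eventually.of_forall fun n i => by
      rw [Real.norm_eq_abs, abs_mul]
      refine mul_le_mul_of_nonneg_right ?_ (abs_nonneg _)
      refine (abs_sub _ _).trans ?_
      linarith [ha n i, ha' n i])
  simpa using h2

lemma summable_abs_mul_realL2 {ι : Type} {s : ι → ℝ} (hs : Summable fun i => s i ^ 2)
    (ψ : RealL2 ι) : Summable fun i => |s i * ψ i| :=
  (realL2_hasSum_inner (⟨s, memlp_two_of_summable_sq hs⟩ : RealL2 ι) ψ).summable.abs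

/-- Eigenvectors of an operator with the lattice kernel solve the first-order system. -/
lemma latticeSystem_of_eigenvector (K : KernelData (ℕ ⊕ ℕ)) (hA : K.A = latticeKernel)
    (hs : ∀ i, K.s i ≠ 0) {ψ : RealL2 (ℕ ⊕ ℕ)} {τ : ℝ} (hψ : K.op ψ = τ • ψ) :
    LatticeSystem (fun i => K.s i ^ 2) K.d τ (fun k => inner ℝ (K.row k) ψ)
      (fun i => ψ i / K.s i) := by
  have hX : ∀ k, HasSum (fun i => latticeKernel k i * (K.s i * ψ i)) (inner ℝ (K.row k) ψ) := by
    intro k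
    simpa only [hA] using K.hasSum_inner_row k ψ
  have hY : ∀ i, HasSum (fun k => latticeKernel k i * (K.d k * inner ℝ (K.row k) ψ))
      (τ * (ψ i / K.s i)) := by
    intro i
    have h1 := (K.hasSum_op_apply ψ i).div_const (K.s i)
    simp only [mul_div_cancel_right₀ _ (hs i), hA] at h1
    rw [hψ, lp.coeFn_smul, Pi.smul_apply, smul_eq_mul, mul_div_assoc] at h1
    exact h1
  have hσ : ∀ i, K.s i ^ 2 * (ψ i / K.s i) = K.s i * ψ i := fun i => by
    field_simp [hs i]
  have hsum1 := summable_abs_mul_realL2 K.summable_s ψ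
  have hsum2 : Summable fun k => |K.d k * inner ℝ (K.row k) ψ| := by
    obtain ⟨C, hC⟩ := K.abs_inner_row_le ψ
    refine Summable.of_nonneg_of_le (fun _ => abs_nonneg _) (fun k => ?_) (K.summable_d.mul_right C)
    rw [abs_mul]
    exact mul_le_mul_of_nonneg_left (hC k) (abs_nonneg _)
  refine ⟨fun n => ?_, fun n => ?_, ?_, ?_, fun n => ?_, fun n => ?_, ?_⟩
  · rw [hσ]
    exact hasSum_sub_eq_of_delta (f := fun i => K.s i * ψ i) (hX _) (hX _) (latticeKernel_left_inl n)
  · rw [hσ]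
    exact hasSum_sub_eq_of_delta (f := fun i => K.s i * ψ i) (hX _) (hX _) (latticeKernel_left_inr n)
  · exact tendsto_hasSum_sub hsum1 (fun n i => abs_latticeKernel_le _ i)
      (fun n i => abs_latticeKernel_le _ i) (fun n => hX _) (fun n => hX _)
      tendsto_latticeKernel_left
  · have h1 := hasSum_sub_eq_of_delta (a' := fun _ => 0) (S' := 0) (hY (.inr 0))
      (by simp) (fun k => by rw [sub_zero]; exact latticeKernel_right_zero k)
    simpa using h1
  · rw [mul_sub]
    exact hasSum_sub_eq_of_delta (f := fun k => K.d k * inner ℝ (K.row k) ψ) (hY _) (hY _)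
      (latticeKernel_right_inr n)
  · rw [mul_sub]
    exact hasSum_sub_eq_of_delta (f := fun k => K.d k * inner ℝ (K.row k) ψ) (hY _) (hY _)
      (latticeKernel_right_inl n)
  · simp only [mul_sub]
    exact tendsto_hasSum_sub (a := fun n k => latticeKernel k (.inl n))
      (a' := fun n k => latticeKernel k (.inr n)) hsum2 (fun n i => abs_latticeKernel_le i _)
      (fun n i => abs_latticeKernel_le i _) (fun n => hY _) (fun n => hY _)
      tendsto_latticeKernel_right

/-- The boundary condition at `y = 1`, satisfied by every vector. -/
lemma inner_row_inl_zero (K : KernelData (ℕ ⊕ ℕ)) (hA : K.A = latticeKernel)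
    (ψ : RealL2 (ℕ ⊕ ℕ)) : inner ℝ (K.row (.inl 0)) ψ = 0 := by
  refine (K.hasSum_inner_row (.inl 0) ψ).unique ?_
  convert! hasSum_zero using 2 with i
  rw [hA]
  rcases i with m | m <;> simp [latticeKernel]

/-- The operator is injective: its kernel solves the system with `τ = 0`. -/
lemma eq_zero_of_op_eq_zero (K : KernelData (ℕ ⊕ ℕ)) (hA : K.A = latticeKernel)
    (hs : ∀ i, K.s i ≠ 0) (hd : ∀ i, K.d i ≠ 0) {ψ : RealL2 (ℕ ⊕ ℕ)} (hψ : K.op ψ = 0) :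
    ψ = 0 := by
  have h := latticeSystem_of_eigenvector K hA hs (τ := 0) (ψ := ψ) (by rw [hψ, zero_smul])
  have hX : ∀ k, inner ℝ (K.row k) ψ = 0 := by
    rintro ((_ | n) | (_ | n))
    · exact inner_row_inl_zero K hA ψ
    · have := h.Y_inl n
      rw [zero_mul] at this
      exact (mul_eq_zero.1 this.symm).resolve_left (hd _)
    · have := h.Y_zero
      rw [zero_mul] at this
      exact (mul_eq_zero.1 this.symm).resolve_left (hd _)
    · have := h.Y_inr n
      rw [zero_mul] at this
      exact (mul_eq_zero.1 this.symm).resolve_left (hd _)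
  have hY : ∀ i, K.s i ^ 2 * (ψ i / K.s i) = 0 → ψ i = 0 := fun i hi => by
    have h1 := (mul_eq_zero.1 hi).resolve_left (pow_ne_zero 2 (hs i))
    exact (div_eq_zero_iff.1 h1).resolve_right (hs i)
  ext i
  rcases i with n | n
  · have := h.X_inl n
    simp only [hX, sub_self] at this
    exact hY _ this.symm
  · have := h.X_inr n
    simp only [hX, sub_self] at this
    exact hY _ this.symm

/-! ### Eigenvectors are big `q`-Bessel functions -/

section core

variable {p b : ℝ}

/-- The kernel data of the inverse of the second-order `p`-difference operator whose eigenfunctions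
are the functions `besselSeries p (b * p) · z`, in the coordinates `√(|y| w(y)) v(y)` that identify
the weighted space on the lattice with `ℓ²`. -/
def besselKernel (hp0 : 0 < p) (hp1 : p < 1) (hb0 : 0 < b) (hbp : b * p < 1) :
    KernelData (ℕ ⊕ ℕ) where
  A := latticeKernel
  s i := √(|latticePt p i| * (latticeWeight p b (latticePt p i))⁻¹)
  d i := |latticePt p i| * companionWeight p b (latticePt p i)
  abs_A_le := abs_latticeKernel_le
  summable_s := by
    obtain ⟨C, -, hC⟩ := exists_abs_inv_latticeWeight_le hp0 hp1 hb0 hbp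
    refine (summable_abs_latticePt_mul hp0 hp1 hC).congr fun i => (Real.sq_sqrt ?_).symm
    have := latticeWeight_pos hp0 hp1 hb0 hbp (abs_latticePt_le_one hp0 hp1 i)
    positivity
  summable_d := by
    obtain ⟨C, -, hC⟩ := exists_abs_companionWeight_le hp0 hp1 hb0 hbp
    exact (summable_abs_latticePt_mul hp0 hp1 hC).abs

lemma besselKernel_s_sq (hp0 : 0 < p) (hp1 : p < 1) (hb0 : 0 < b) (hbp : b * p < 1)
    (i : ℕ ⊕ ℕ) : (besselKernel hp0 hp1 hb0 hbp).s i ^ 2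
      = |latticePt p i| * (latticeWeight p b (latticePt p i))⁻¹ := by
  have := latticeWeight_pos hp0 hp1 hb0 hbp (abs_latticePt_le_one hp0 hp1 i)
  exact Real.sq_sqrt (by positivity)

lemma besselKernel_s_pos (hp0 : 0 < p) (hp1 : p < 1) (hb0 : 0 < b) (hbp : b * p < 1)
    (i : ℕ ⊕ ℕ) : 0 < (besselKernel hp0 hp1 hb0 hbp).s i :=
  Real.sqrt_pos.2 (mul_pos (abs_latticePt_pos hp0 i)
    (inv_pos.2 (latticeWeight_pos hp0 hp1 hb0 hbp (abs_latticePt_le_one hp0 hp1 i))))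

/-- The raising formula in self-adjoint form. -/
lemma latticeWeight_mul_besselSeries_sub (hp0 : 0 < p) (hp1 : p < 1) (hb0 : 0 < b)
    (hbp : b * p < 1) (hb : ∀ k : ℕ, b * p ^ k ≠ 1) (z : ℝ) {t : ℝ} (ht : |t| ≤ 1) :
    latticeWeight p b t * besselSeries p (b * p) t z
        - latticeWeight p b (p * t) * besselSeries p (b * p) (p * t) z
      = (1 - b) * (p * t) * companionWeight p b (p * t) * besselSeries p b (p * t) z := by
  have h1 := besselSeries_raise hp0 hp1 hb0 hb z ht
  have h2 := latticeWeight_mul hp0 hp1 hb0 hbp ht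
  have h3 : 1 + b * (p * t) ≠ 0 := by
    have := mul_lt_one_of_abs_le (mul_pos hb0 hp0) hbp ht
    rw [← mul_assoc]
    linarith
  rw [companionWeight, mul_div_assoc', div_mul_eq_mul_div, eq_div_iff h3]
  linear_combination latticeWeight p b (p * t) * h1 + besselSeries p (b * p) t z * h2

lemma latticeSystem_besselSeries (hp0 : 0 < p) (hp1 : p < 1) (hb0 : 0 < b) (hbp : b * p < 1)
    (hb : ∀ k : ℕ, b * p ^ k ≠ 1) {τ z : ℝ} (hz : b * τ * z = 1) :
    LatticeSystem (fun i => (besselKernel hp0 hp1 hb0 hbp).s i ^ 2)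
      (besselKernel hp0 hp1 hb0 hbp).d τ
      (fun i => (1 - b) * τ * besselSeries p b (latticePt p i) z)
      (fun i => latticeWeight p b (latticePt p i) * besselSeries p (b * p) (latticePt p i) z) := by
  have hb1 : 1 - b ≠ 0 := sub_ne_zero.2 (by simpa using (hb 0).symm)
  have hbp' := mul_pow_ne_one hp0 hp1 hbp
  have hw : ∀ i, latticeWeight p b (latticePt p i) ≠ 0 := fun i =>
    (latticeWeight_pos hp0 hp1 hb0 hbp (abs_latticePt_le_one hp0 hp1 i)).ne'
  have hpk : Tendsto (fun k : ℕ => p ^ k) atTop (𝓝 0) :=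
    tendsto_pow_atTop_nhds_zero_of_lt_one hp0.le hp1
  have hpk' : Tendsto (fun k : ℕ => -p ^ k) atTop (𝓝 0) := by simpa using hpk.neg
  -- the lowering formula multiplied by `(1 - b) τ`
  have hlow : ∀ y : ℝ, |y| ≤ 1 → (1 - b) * τ * besselSeries p b y z
      - (1 - b) * τ * besselSeries p b (p * y) z = -y * besselSeries p (b * p) y z := by
    intro y hy
    rw [← mul_sub, besselSeries_sub hp0 hp1 hb0 hb z hy]
    field_simp
    linear_combination (-(y * besselSeries p (b * p) y z)) * hz
  have hs : ∀ i, (besselKernel hp0 hp1 hb0 hbp).s i ^ 2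
      * (latticeWeight p b (latticePt p i) * besselSeries p (b * p) (latticePt p i) z)
      = |latticePt p i| * besselSeries p (b * p) (latticePt p i) z := by
    intro i
    rw [besselKernel_s_sq]
    field_simp [hw i]
  have habs : ∀ n, |latticePt p (.inl n)| = p ^ n := fun n => abs_latticePt hp0 _
  have habs' : ∀ n, |latticePt p (.inr n)| = p ^ n := fun n => abs_latticePt hp0 _
  refine ⟨fun n => ?_, fun n => ?_, ?_, ?_, fun n => ?_, fun n => ?_, ?_⟩
  · have h1 := hlow _ (abs_latticePt_le_one hp0 hp1 (.inl n))
    rw [hs, habs]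
    simp only [latticePt_inl, pow_succ'] at h1 ⊢
    linarith
  · have h1 := hlow _ (abs_latticePt_le_one hp0 hp1 (.inr n))
    rw [hs, habs']
    simp only [latticePt_inr, pow_succ', mul_neg, neg_neg] at h1 ⊢
    linarith
  · have h1 := ((tendsto_besselSeries_zero hp0 hp1 hb0 hb z hpk).sub
      (tendsto_besselSeries_zero hp0 hp1 hb0 hb z hpk')).const_mul ((1 - b) * τ)
    rw [sub_self, mul_zero] at h1
    simp only [mul_sub] at h1
    exact h1
  · change _ = |latticePt p (.inr 0)| * companionWeight p b (latticePt p (.inr 0)) * _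
    simp only [latticePt_inr, pow_zero, besselSeries_neg_one, companionWeight, abs_neg, abs_one]
    rw [mul_neg_one, ← sub_eq_add_neg]
    field_simp
  · have h1 := latticeWeight_mul_besselSeries_sub hp0 hp1 hb0 hbp hb z
      (abs_latticePt_le_one hp0 hp1 (.inr n))
    change _ = |latticePt p (.inr (n + 1))| * companionWeight p b (latticePt p (.inr (n + 1))) * _
    rw [habs']
    simp only [latticePt_inr, pow_succ', mul_neg] at h1 ⊢
    linear_combination (-τ) * h1
  · have h1 := latticeWeight_mul_besselSeries_sub hp0 hp1 hb0 hbp hb z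
      (abs_latticePt_le_one hp0 hp1 (.inl n))
    change _ = |latticePt p (.inl (n + 1))| * companionWeight p b (latticePt p (.inl (n + 1))) * _
    rw [habs]
    simp only [latticePt_inl, pow_succ'] at h1 ⊢
    linear_combination τ * h1
  · have h1 := (((tendsto_weight_inl hp0 hp1 hb0 hbp).mul
      (tendsto_besselSeries_zero hp0 hp1 (mul_pos hb0 hp0) hbp' z hpk)).sub
      ((tendsto_weight_inr hp0 hp1 hb0 hbp).mul
      (tendsto_besselSeries_zero hp0 hp1 (mul_pos hb0 hp0) hbp' z hpk'))).const_mul τ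
    rw [sub_self, mul_zero] at h1
    exact h1

/-- An eigenvector with nonzero eigenvalue `τ` is a multiple of the big `q`-Bessel function at
`z = 1 / (b τ)`, and this `z` is a zero of the companion function at `y = 1`. -/
lemma eigenvector_eq_besselSeries (hp0 : 0 < p) (hp1 : p < 1) (hb0 : 0 < b) (hbp : b * p < 1)
    (hb : ∀ k : ℕ, b * p ^ k ≠ 1) {τ z : ℝ} (hz : b * τ * z = 1) {ψ : RealL2 (ℕ ⊕ ℕ)}
    (hψ : (besselKernel hp0 hp1 hb0 hbp).op ψ = τ • ψ) (hψ0 : ψ ≠ 0) :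
    besselSeries p b 1 z = 0 ∧ ∃ c : ℝ, c ≠ 0 ∧ ∀ i, ψ i = c *
      ((besselKernel hp0 hp1 hb0 hbp).s i *
        (latticeWeight p b (latticePt p i) * besselSeries p (b * p) (latticePt p i) z)) := by
  set K := besselKernel hp0 hp1 hb0 hbp with hK
  have hs : ∀ i, K.s i ≠ 0 := fun i => (besselKernel_s_pos hp0 hp1 hb0 hbp i).ne'
  have hτ : τ ≠ 0 := by rintro rfl; simp at hz
  have hb1 : 1 - b ≠ 0 := sub_ne_zero.2 (by simpa using (hb 0).symm)
  have h1 := latticeSystem_of_eigenvector K rfl hs hψ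
  have h2 := latticeSystem_besselSeries hp0 hp1 hb0 hbp hb hz
  have hw0 : latticeWeight p b (latticePt p (.inr 0)) ≠ 0 :=
    (latticeWeight_pos hp0 hp1 hb0 hbp (abs_latticePt_le_one hp0 hp1 _)).ne'
  -- `c` matches the two solutions at `y = -1`, where the series equals `1`
  set c : ℝ := ψ (.inr 0) / K.s (.inr 0) / latticeWeight p b (latticePt p (.inr 0)) with hc
  have h3 := h1.sub_smul h2 c
  obtain ⟨C₁, hC₁, hw⟩ := exists_abs_inv_latticeWeight_le hp0 hp1 hb0 hbp
  obtain ⟨C₂, hC₂, hv⟩ := exists_abs_companionWeight_le hp0 hp1 hb0 hbp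
  have h4 := h3.eq_zero (p := p) (C := max C₁ C₂) hτ
    (mul_ne_zero (abs_latticePt_pos hp0 _).ne' (companionWeight_ne_zero hp0 hp1 hb0 hbp hb _))
    hp0 hp1 (hC₁.trans (le_max_left _ _)) (fun n => by
      have := hw (.inl n)
      rw [hK, besselKernel_s_sq, abs_mul, abs_abs, abs_latticePt hp0, mul_comm]
      exact mul_le_mul_of_nonneg_right (this.trans (le_max_left _ _)) (pow_pos hp0 _).le)
    (fun n => by
      have := hv (.inl n)
      change |(|latticePt p (.inl n)| * companionWeight p b (latticePt p (.inl n)))| ≤ _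
      rw [abs_mul, abs_abs, abs_latticePt hp0, mul_comm]
      exact mul_le_mul_of_nonneg_right (this.trans (le_max_right _ _)) (pow_pos hp0 _).le)
    (by
      have h5 : latticePt p (.inr 0) = -1 := by simp
      rw [hc, h5, besselSeries_neg_one, mul_one, div_mul_cancel₀ _ (h5 ▸ hw0), sub_self])
  have h5 : ∀ i, ψ i = c * (K.s i *
      (latticeWeight p b (latticePt p i) * besselSeries p (b * p) (latticePt p i) z)) := by
    intro i
    have h6 := (h4 i).2
    have h7 := hs i
    rw [sub_eq_zero, div_eq_iff h7] at h6
    rw [h6]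
    ring
  have hc0 : c ≠ 0 := by
    intro h0
    apply hψ0
    ext i
    rw [h5 i, h0, zero_mul]
    rfl
  refine ⟨?_, c, hc0, h5⟩
  have h6 := (h4 (.inl 0)).1
  rw [inner_row_inl_zero K rfl ψ, zero_sub, neg_eq_zero] at h6
  have h7 := (mul_eq_zero.1 ((mul_eq_zero.1 h6).resolve_left hc0)).resolve_left
    (mul_ne_zero hb1 hτ)
  simpa using h7

/-- Two eigenvectors with negative eigenvalues are never orthogonal, being of constant sign. -/
lemma inner_ne_zero_of_neg (hp0 : 0 < p) (hp1 : p < 1) (hb0 : 0 < b) (hbp : b * p < 1)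
    (hb : ∀ k : ℕ, b * p ^ k ≠ 1) {τ τ' : ℝ} (hτ : τ < 0) (hτ' : τ' < 0)
    {ψ ψ' : RealL2 (ℕ ⊕ ℕ)}
    (hψ : (besselKernel hp0 hp1 hb0 hbp).op ψ = τ • ψ) (hψ0 : ψ ≠ 0)
    (hψ' : (besselKernel hp0 hp1 hb0 hbp).op ψ' = τ' • ψ') (hψ0' : ψ' ≠ 0) :
    inner ℝ ψ ψ' ≠ 0 := by
  have hpos : ∀ τ : ℝ, τ < 0 → ∀ i, 0 < (besselKernel hp0 hp1 hb0 hbp).s i *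
      (latticeWeight p b (latticePt p i) * besselSeries p (b * p) (latticePt p i) (b * τ)⁻¹) := by
    intro τ hτ i
    refine mul_pos (besselKernel_s_pos hp0 hp1 hb0 hbp i) (mul_pos
      (latticeWeight_pos hp0 hp1 hb0 hbp (abs_latticePt_le_one hp0 hp1 i)) ?_)
    refine besselSeries_pos hp0 hp1 (mul_pos hb0 hp0) hbp
      (inv_nonpos.2 (mul_neg_of_pos_of_neg hb0 hτ).le) ?_
    rcases i with n | n
    · exact ⟨n, .inl rfl⟩
    · exact ⟨n, .inr rfl⟩
  obtain ⟨-, c, hc, h⟩ := eigenvector_eq_besselSeries hp0 hp1 hb0 hbp hb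
    (mul_inv_cancel₀ (mul_ne_zero hb0.ne' hτ.ne)) hψ hψ0
  obtain ⟨-, c', hc', h'⟩ := eigenvector_eq_besselSeries hp0 hp1 hb0 hbp hb
    (mul_inv_cancel₀ (mul_ne_zero hb0.ne' hτ'.ne)) hψ' hψ0'
  intro h0
  have h1 := (realL2_hasSum_inner ψ ψ').div_const (c * c')
  rw [h0, zero_div] at h1
  have h2 : ∀ i, 0 < ψ i * ψ' i / (c * c') := by
    intro i
    rw [h i, h' i]
    have := mul_pos (hpos τ hτ i) (hpos τ' hτ' i)
    convert! this using 1
    field_simp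
  have h3 := le_hasSum h1 (.inl 0) fun i _ => (h2 i).le
  exact absurd (h2 (.inl 0)) (not_lt.2 h3)

/-- A symmetric compact injective operator with at most one negative direction: a vector orthogonal
to all eigenvectors with positive eigenvalue vanishes as soon as some linear functional kills it
and kills no eigenvector with negative eigenvalue. -/
lemma eq_zero_of_orthogonal_pos_eigenvectors {E : Type*} [NormedAddCommGroup E]
    [InnerProductSpace ℝ E] [CompleteSpace E] {T : E →L[ℝ] E} (hT : IsCompactOperator T)
    (hsymm : T.IsSymmetric) (hinj : ∀ ψ, T ψ = 0 → ψ = 0)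
    (hneg : ∀ τ τ' : ℝ, τ < 0 → τ' < 0 → ∀ ψ ψ' : E, T ψ = τ • ψ → ψ ≠ 0 → T ψ' = τ' • ψ' →
      ψ' ≠ 0 → inner ℝ ψ ψ' ≠ 0)
    (ℓ : E →ₗ[ℝ] ℝ) (hℓ : ∀ τ : ℝ, τ < 0 → ∀ ψ, T ψ = τ • ψ → ψ ≠ 0 → ℓ ψ ≠ 0)
    {φ : E} (hφ : ℓ φ = 0) (hpos : ∀ τ : ℝ, 0 < τ → ∀ ψ, T ψ = τ • ψ → inner ℝ ψ φ = 0) :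
    φ = 0 := by
  have hzero : ∀ χ : E, (∀ τ : ℝ, τ ≠ 0 → ∀ ψ, T ψ = τ • ψ → inner ℝ ψ χ = 0) → χ = 0 := by
    intro χ hχ
    have hmem : χ ∈ (⨆ μ, Module.End.eigenspace (T : Module.End ℝ E) μ)ᗮ := by
      rw [← Submodule.iInf_orthogonal, Submodule.mem_iInf]
      intro μ
      rw [Submodule.mem_orthogonal]
      intro ψ hψ
      have hψ' : T ψ = μ • ψ := Module.End.mem_eigenspace_iff.1 hψ
      rcases eq_or_ne μ 0 with rfl | hμ
      · rw [zero_smul] at hψ'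
        rw [hinj ψ hψ', inner_zero_left]
      · exact hχ μ hμ ψ hψ'
    rwa [ContinuousLinearMap.orthogonalComplement_iSup_eigenspaces_eq_bot hT hsymm,
      Submodule.mem_bot] at hmem
  by_cases hex : ∃ τ₀ : ℝ, τ₀ < 0 ∧ ∃ ψ₀, T ψ₀ = τ₀ • ψ₀ ∧ ψ₀ ≠ 0
  swap
  · push Not at hex
    refine hzero φ fun τ hτ ψ hψ => ?_
    rcases lt_or_gt_of_ne hτ with h | h
    · rw [hex τ h ψ hψ, inner_zero_left]
    · exact hpos τ h ψ hψ
  obtain ⟨τ₀, hτ₀, ψ₀, hψ₀, hne⟩ := hex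
  have hn : inner ℝ ψ₀ ψ₀ ≠ (0 : ℝ) := hneg τ₀ τ₀ hτ₀ hτ₀ ψ₀ ψ₀ hψ₀ hne hψ₀ hne
  -- eigenvectors of different eigenvalues are orthogonal
  have horth : ∀ τ : ℝ, τ ≠ τ₀ → ∀ ψ, T ψ = τ • ψ → inner ℝ ψ ψ₀ = 0 := by
    intro τ hτ ψ hψ
    have h1 : inner ℝ (T ψ) ψ₀ = inner ℝ ψ (T ψ₀) := hsymm ψ ψ₀
    rw [hψ, hψ₀, real_inner_smul_left, real_inner_smul_right] at h1
    have h2 : (τ - τ₀) * inner ℝ ψ ψ₀ = 0 := by linarith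
    exact (mul_eq_zero.1 h2).resolve_left (sub_ne_zero.2 hτ)
  set t : ℝ := inner ℝ ψ₀ φ / inner ℝ ψ₀ ψ₀ with ht
  have hproj : inner ℝ ψ₀ (φ - t • ψ₀) = 0 := by
    rw [inner_sub_right, real_inner_smul_right, ht, div_mul_cancel₀ _ hn, sub_self]
  have h0 : φ - t • ψ₀ = 0 := by
    refine hzero _ fun τ hτ ψ hψ => ?_
    rcases lt_or_gt_of_ne hτ with h | h
    · -- any negative eigenvector is a multiple of `ψ₀`
      have hττ : τ = τ₀ ∨ ψ = 0 := by
        by_contra! hcon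
        exact hneg τ τ₀ h hτ₀ ψ ψ₀ hψ hcon.2 hψ₀ hne (horth τ hcon.1 ψ hψ)
      rcases hττ with rfl | rfl
      · set u : ℝ := inner ℝ ψ₀ ψ / inner ℝ ψ₀ ψ₀ with hu
        have h1 : ψ - u • ψ₀ = 0 := by
          by_contra h2
          refine hneg τ τ h h ψ₀ (ψ - u • ψ₀) hψ₀ hne ?_ h2 ?_
          · rw [map_sub, map_smul, hψ, hψ₀, smul_sub, smul_comm]
          · rw [inner_sub_right, real_inner_smul_right, hu, div_mul_cancel₀ _ hn, sub_self]
        rw [sub_eq_zero.1 h1, real_inner_smul_left, hproj, mul_zero]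
      · rw [inner_zero_left]
    · rw [inner_sub_right, real_inner_smul_right, hpos τ h ψ hψ,
        horth τ (by linarith) ψ hψ, mul_zero, sub_zero]
  have h1 : φ = t • ψ₀ := sub_eq_zero.1 h0
  have h2 := hφ
  rw [h1, map_smul, smul_eq_mul] at h2
  rw [h1, (mul_eq_zero.1 h2).resolve_right (hℓ τ₀ hτ₀ ψ₀ hψ₀ hne), zero_smul]

/-- Completeness in real form, for square-summable sequences on the points `p^n`. -/
theorem eq_zero_of_forall_besselSeries_zero (hp0 : 0 < p) (hp1 : p < 1) (hb0 : 0 < b)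
    (hbp : b * p < 1) (hb1 : b ≠ 1) {G : ℕ → ℝ} (hG : Summable fun n => p ^ n * G n ^ 2)
    (h : ∀ z : ℝ, 0 < z → besselSeries p b 1 z = 0 →
      ∑' n : ℕ, p ^ n * latticeWeight p b (p ^ n) * G n * besselSeries p (b * p) (p ^ n) z = 0)
    (n : ℕ) : G n = 0 := by
  have hb := mul_pow_ne_one_of_mul_lt_one hp0 hp1 hb1 hbp
  set K := besselKernel hp0 hp1 hb0 hbp with hK
  have hs : ∀ i, K.s i ≠ 0 := fun i => (besselKernel_s_pos hp0 hp1 hb0 hbp i).ne'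
  have hw : ∀ i, 0 < latticeWeight p b (latticePt p i) := fun i =>
    latticeWeight_pos hp0 hp1 hb0 hbp (abs_latticePt_le_one hp0 hp1 i)
  have hss : ∀ i, K.s i ^ 2 * latticeWeight p b (latticePt p i) = |latticePt p i| := fun i => by
    rw [hK, besselKernel_s_sq, mul_assoc, inv_mul_cancel₀ (hw i).ne', mul_one]
  -- the extension of `G` by zero to the negative half of the lattice
  let f : ℕ ⊕ ℕ → ℝ := Sum.elim
    (fun n => K.s (.inl n) * latticeWeight p b (latticePt p (.inl n)) * G n) (fun _ => 0)
  have hf : Summable fun i => f i ^ 2 := by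
    obtain ⟨C, hC0, hC⟩ := exists_abs_latticeWeight_le hp0 hp1 hb0 hbp
    have h1 : Summable fun n => f (.inl n) ^ 2 := by
      refine Summable.of_nonneg_of_le (fun n => sq_nonneg _) (fun n => ?_) (hG.mul_left C)
      have h2 := hss (.inl n)
      rw [abs_latticePt hp0] at h2
      change _ = p ^ n at h2
      have h3 : f (.inl n) ^ 2 = latticeWeight p b (latticePt p (.inl n)) * (p ^ n * G n ^ 2) := by
        change (K.s (.inl n) * latticeWeight p b (latticePt p (.inl n)) * G n) ^ 2 = _
        linear_combination (latticeWeight p b (latticePt p (.inl n)) * G n ^ 2) * h2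
      rw [h3]
      exact mul_le_mul_of_nonneg_right ((le_abs_self _).trans (hC _))
        (mul_nonneg (pow_pos hp0 n).le (sq_nonneg _))
    exact (HasSum.sum (f := fun i => f i ^ 2) (b := 0) h1.hasSum
      (by simp [Function.comp_def, f])).summable
  let φ : RealL2 (ℕ ⊕ ℕ) := ⟨f, memlp_two_of_summable_sq hf⟩
  have hφ : ∀ i, φ i = f i := fun _ => rfl
  have key : φ = 0 := by
    refine eq_zero_of_orthogonal_pos_eigenvectors K.isCompactOperator_op K.isSymmetric_op
      (fun ψ => eq_zero_of_op_eq_zero K rfl hs fun i => mul_ne_zero (abs_latticePt_pos hp0 i).ne'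
        (companionWeight_ne_zero hp0 hp1 hb0 hbp hb i))
      (fun τ τ' hτ hτ' ψ ψ' hψ h0 hψ' h0' =>
        inner_ne_zero_of_neg hp0 hp1 hb0 hbp hb hτ hτ' hψ h0 hψ' h0')
      (lp.evalCLM ℝ (fun _ : ℕ ⊕ ℕ => ℝ) 2 (.inr 0)).toLinearMap ?_ ?_ ?_
    · intro τ hτ ψ hψ h0
      change ψ (.inr 0) ≠ 0
      obtain ⟨-, c, hc, h1⟩ := eigenvector_eq_besselSeries hp0 hp1 hb0 hbp hb
        (mul_inv_cancel₀ (mul_ne_zero hb0.ne' hτ.ne)) hψ h0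
      rw [h1]
      refine mul_ne_zero hc (mul_ne_zero (hs _) (mul_ne_zero (hw _).ne' ?_))
      simp [besselSeries_neg_one]
    · rfl
    · intro τ hτ ψ hψ
      rcases eq_or_ne ψ 0 with rfl | h0
      · exact inner_zero_left _
      obtain ⟨hz, c, hc, h1⟩ := eigenvector_eq_besselSeries hp0 hp1 hb0 hbp hb
        (mul_inv_cancel₀ (mul_ne_zero hb0.ne' hτ.ne')) hψ h0
      have h2 := h _ (inv_pos.2 (mul_pos hb0 hτ)) hz
      have h3 := (realL2_hasSum_inner ψ φ).tsum_eq
      rw [← h3, ← Function.Injective.tsum_eq Sum.inl_injective]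
      · rw [← mul_zero c, ← h2, ← tsum_mul_left]
        refine tsum_congr fun n => ?_
        rw [h1, hφ]
        have h4 := hss (.inl n)
        rw [abs_latticePt hp0] at h4
        change _ * (K.s (.inl n) * latticeWeight p b (latticePt p (.inl n)) * G n) = _
        simp only [latticePt_inl, Sum.elim_inl, id] at h4 ⊢
        linear_combination (c * latticeWeight p b (p ^ n) * G n
          * besselSeries p (b * p) (p ^ n) (b * τ)⁻¹) * h4
      · rintro (m | m) hm
        · exact ⟨m, rfl⟩
        · exact absurd (mul_zero _) hm
  have h1 : f (.inl n) = 0 := by rw [← hφ, key]; rfl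
  exact (mul_eq_zero.1 h1).resolve_left (mul_ne_zero (hs _) (hw _).ne')

end core

/-! ### Translation to the big `q`-Bessel function and the weighted spaces -/

lemma bigQBessel_ofReal (q α : ℝ) {x : ℝ} (hx : x ≠ 0) (l : ℝ) :
    bigQBessel q α (x : ℂ) (l : ℂ)
      = ((besselSeries (q ^ 2) (q ^ (2 * α + 2)) (x ^ 2) (l ^ 2) : ℝ) : ℂ) := by
  rw [bigQBessel, phi11, besselSeries, Complex.ofReal_tsum]
  refine tsum_congr fun k => ?_
  have h1 : shiftPoly (q ^ 2) k (x ^ 2) = qShifted (-1 / x ^ 2) (q ^ 2) k * (x ^ 2) ^ k := by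
    have hpow : (x ^ 2) ^ k = ∏ _i ∈ Finset.range k, x ^ 2 := by simp
    rw [shiftPoly, qShifted, hpow, ← Finset.prod_mul_distrib]
    refine Finset.prod_congr rfl fun i _ => ?_
    field_simp
    ring
  rw [h1, besselCoeff]
  simp only [qShifted]
  push_cast
  rw [mul_pow, mul_pow, neg_pow ((q ^ (2 * α + 2) : ℝ) : ℂ)]
  ring

lemma rpow_mul_sq {q : ℝ} (hq0 : 0 < q) (c : ℝ) : q ^ c * q ^ 2 = q ^ (c + 2) := by
  rw [Real.rpow_add hq0, Real.rpow_two]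

lemma bigQBessel_succ_ofReal {q : ℝ} (hq0 : 0 < q) (α : ℝ) {x : ℝ} (hx : x ≠ 0) (l : ℝ) :
    bigQBessel q (α + 1) (x : ℂ) (l : ℂ)
      = ((besselSeries (q ^ 2) (q ^ (2 * α + 2) * q ^ 2) (x ^ 2) (l ^ 2) : ℝ) : ℂ) := by
  rw [bigQBessel_ofReal q (α + 1) hx l, rpow_mul_sq hq0, show 2 * (α + 1) + 2 = 2 * α + 2 + 2 by ring]

lemma besselWeight_eq {q : ℝ} (hq0 : 0 < q) (α x : ℝ) :
    besselWeight q α x = x * latticeWeight (q ^ 2) (q ^ (2 * α + 2)) (x ^ 2) := by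
  rw [besselWeight, latticeWeight, rpow_mul_sq hq0, show 2 * α + 2 + 2 = 2 * α + 4 by ring,
    mul_div_assoc]
  congr 3 <;> ring

section translation

variable {q α : ℝ}

lemma param_mul_lt_one (hq0 : 0 < q) (hq1 : q < 1) (hα : -(3 / 2) < α) :
    q ^ (2 * α + 2) * q ^ 2 < 1 := by
  rw [rpow_mul_sq hq0]
  exact Real.rpow_lt_one hq0.le hq1 (by linarith)

lemma param_ne_one (hq0 : 0 < q) (hq1 : q < 1) (hα1 : α ≠ -1) : q ^ (2 * α + 2) ≠ 1 := by
  rcases lt_or_gt_of_ne (show 2 * α + 2 ≠ 0 from fun h => hα1 (by linarith)) with h | h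
  · exact (Real.one_lt_rpow_of_pos_of_lt_one_of_neg hq0 hq1 h).ne'
  · exact (Real.rpow_lt_one hq0.le hq1 h).ne

lemma besselWeight_pow (hq0 : 0 < q) (α : ℝ) (n : ℕ) :
    besselWeight q α (q ^ n) * q ^ n
      = (q ^ 2) ^ n * latticeWeight (q ^ 2) (q ^ (2 * α + 2)) ((q ^ 2) ^ n) := by
  rw [besselWeight_eq hq0, ← pow_mul, ← pow_mul, mul_comm n 2, pow_mul' q 2 n]
  ring

lemma exists_latticeWeight_bounds (hq0 : 0 < q) (hq1 : q < 1) (hα : -(3 / 2) < α) :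
    ∃ C : ℝ, 0 ≤ C ∧ ∀ n : ℕ,
      0 < latticeWeight (q ^ 2) (q ^ (2 * α + 2)) ((q ^ 2) ^ n) ∧
      latticeWeight (q ^ 2) (q ^ (2 * α + 2)) ((q ^ 2) ^ n) ≤ C ∧
      1 ≤ C * latticeWeight (q ^ 2) (q ^ (2 * α + 2)) ((q ^ 2) ^ n) := by
  have hp0 : 0 < q ^ 2 := by positivity
  have hp1 : q ^ 2 < 1 := pow_lt_one₀ hq0.le hq1 two_ne_zero
  have hb0 : 0 < q ^ (2 * α + 2) := Real.rpow_pos_of_pos hq0 _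
  have hbp := param_mul_lt_one hq0 hq1 hα
  obtain ⟨C₁, hC₁, h₁⟩ := exists_abs_latticeWeight_le hp0 hp1 hb0 hbp
  obtain ⟨C₂, hC₂, h₂⟩ := exists_abs_inv_latticeWeight_le hp0 hp1 hb0 hbp
  refine ⟨max C₁ C₂, hC₁.trans (le_max_left _ _), fun n => ?_⟩
  have hpos := latticeWeight_pos hp0 hp1 hb0 hbp (abs_latticePt_le_one hp0 hp1 (.inl n))
  refine ⟨hpos, ((le_abs_self _).trans (h₁ (.inl n))).trans (le_max_left _ _), ?_⟩
  have h3 := ((le_abs_self _).trans (h₂ (.inl n))).trans (le_max_right C₁ C₂)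
  have h4 := mul_le_mul_of_nonneg_right h3 hpos.le
  rwa [inv_mul_cancel₀ hpos.ne'] at h4

lemma exists_norm_bigQBessel_le (hq0 : 0 < q) (hq1 : q < 1) (hα : -(3 / 2) < α) (l : ℝ) :
    ∃ C : ℝ, ∀ n : ℕ, ‖bigQBessel q (α + 1) ((q ^ n : ℝ) : ℂ) (l : ℂ)‖ ≤ C := by
  have hp0 : 0 < q ^ 2 := by positivity
  have hp1 : q ^ 2 < 1 := pow_lt_one₀ hq0.le hq1 two_ne_zero
  have hbp0 : 0 < q ^ (2 * α + 2) * q ^ 2 := mul_pos (Real.rpow_pos_of_pos hq0 _) hp0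
  obtain ⟨C, hC⟩ := exists_abs_besselSeries_le hp0 hp1 hbp0
    (mul_pow_ne_one hp0 hp1 (param_mul_lt_one hq0 hq1 hα)) (l ^ 2)
  refine ⟨C, fun n => ?_⟩
  rw [bigQBessel_succ_ofReal hq0 α (pow_pos hq0 n).ne', Complex.norm_real]
  refine hC _ ?_
  rw [abs_of_nonneg (sq_nonneg _)]
  exact pow_le_one₀ (pow_pos hq0 n).le (pow_le_one₀ hq0.le hq1.le)

/-- Completeness for complex square-summable sequences. Zeros `j > 0` of `J_α(1, ·)` correspond to
zeros `z = j² > 0` of the series. -/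
theorem eq_zero_of_forall_besselZeros (hq0 : 0 < q) (hq1 : q < 1) (hα : -(3 / 2) < α)
    (hα1 : α ≠ -1) {g : ℕ → ℂ} (hg : Summable fun n => (q ^ 2) ^ n * ‖g n‖ ^ 2)
    (h : ∀ j ∈ besselZeros q α, ∑' n : ℕ, ((besselWeight q α (q ^ n) * q ^ n : ℝ) : ℂ) * g n
      * bigQBessel q (α + 1) ((q ^ n : ℝ) : ℂ) (j : ℂ) = 0) (n : ℕ) : g n = 0 := by
  have hp0 : 0 < q ^ 2 := by positivity
  have hp1 : q ^ 2 < 1 := pow_lt_one₀ hq0.le hq1 two_ne_zero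
  have hb0 : 0 < q ^ (2 * α + 2) := Real.rpow_pos_of_pos hq0 _
  have hbp := param_mul_lt_one hq0 hq1 hα
  have hb1 := param_ne_one hq0 hq1 hα1
  set p := q ^ 2 with hp
  set b := q ^ (2 * α + 2) with hb
  have hsum : ∀ j : ℝ, Summable fun n : ℕ => ((besselWeight q α (q ^ n) * q ^ n : ℝ) : ℂ) * g n
      * bigQBessel q (α + 1) ((q ^ n : ℝ) : ℂ) (j : ℂ) := by
    intro j
    obtain ⟨C, hC0, hC⟩ := exists_latticeWeight_bounds hq0 hq1 hα
    obtain ⟨D, hD⟩ := exists_norm_bigQBessel_le hq0 hq1 hα j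
    have h1 := (((summable_geometric_of_lt_one hp0.le hp1).add hg).mul_left C).mul_right D
    refine Summable.of_norm_bounded h1 fun n => ?_
    rw [norm_mul, norm_mul, Complex.norm_real, Real.norm_eq_abs, besselWeight_pow hq0]
    obtain ⟨hw0, hwC, -⟩ := hC n
    have hpn : 0 < p ^ n := pow_pos hp0 n
    refine mul_le_mul ?_ (hD n) (norm_nonneg _) (by positivity)
    rw [abs_of_pos (mul_pos hpn hw0), mul_right_comm, mul_comm C]
    refine mul_le_mul ?_ hwC hw0.le (by positivity)
    have h2 : ‖g n‖ ≤ 1 + ‖g n‖ ^ 2 := by nlinarith [sq_nonneg (‖g n‖ - 1), norm_nonneg (g n)]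
    calc p ^ n * ‖g n‖ ≤ p ^ n * (1 + ‖g n‖ ^ 2) := mul_le_mul_of_nonneg_left h2 hpn.le
      _ = _ := by ring
  have hterm : ∀ (z : ℝ), 0 < z → ∀ n : ℕ,
      ((besselWeight q α (q ^ n) * q ^ n : ℝ) : ℂ) * g n
        * bigQBessel q (α + 1) ((q ^ n : ℝ) : ℂ) ((√z : ℝ) : ℂ)
      = ((p ^ n * latticeWeight p b (p ^ n) * besselSeries p (b * p) (p ^ n) z : ℝ) : ℂ)
        * g n := by
    intro z hz n
    rw [bigQBessel_succ_ofReal hq0 α (pow_pos hq0 n).ne', Real.sq_sqrt hz.le, besselWeight_pow hq0,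
      ← hp, ← hb, show (q ^ n) ^ 2 = p ^ n by rw [hp, ← pow_mul, ← pow_mul, mul_comm]]
    push_cast
    ring
  have hzero : ∀ z : ℝ, 0 < z → besselSeries p b 1 z = 0 →
      HasSum (fun n : ℕ =>
        ((p ^ n * latticeWeight p b (p ^ n) * besselSeries p (b * p) (p ^ n) z : ℝ) : ℂ)
        * g n) 0 := by
    intro z hz h0
    have hmem : √z ∈ besselZeros q α := by
      refine ⟨Real.sqrt_pos.2 hz, ?_⟩
      have := bigQBessel_ofReal q α one_ne_zero (√z)
      rw [Complex.ofReal_one] at this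
      rw [this, Real.sq_sqrt hz.le, one_pow, ← hp, ← hb, h0, Complex.ofReal_zero]
    have h1 := (hsum (√z)).hasSum
    rw [h _ hmem] at h1
    exact h1.congr_fun fun n => (hterm z hz n).symm
  have hcomp : ∀ f : ℂ → ℝ, (∀ w, |f w| ≤ ‖w‖) →
      Summable fun n => p ^ n * (f (g n)) ^ 2 := by
    intro f hf
    refine Summable.of_nonneg_of_le (fun n => by positivity) (fun n => ?_) hg
    refine mul_le_mul_of_nonneg_left ?_ (pow_pos hp0 n).le
    rw [← sq_abs]
    exact pow_le_pow_left₀ (abs_nonneg _) (hf _) 2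
  apply Complex.ext
  · refine eq_zero_of_forall_besselSeries_zero hp0 hp1 hb0 hbp hb1
      (G := fun n => (g n).re) (hcomp _ Complex.abs_re_le_norm) (fun z hz h0 => ?_) n
    have h1 := Complex.hasSum_re (hzero z hz h0)
    simp only [Complex.re_ofReal_mul, Complex.zero_re] at h1
    rw [← h1.tsum_eq]
    exact tsum_congr fun n => by ring
  · refine eq_zero_of_forall_besselSeries_zero hp0 hp1 hb0 hbp hb1
      (G := fun n => (g n).im) (hcomp _ Complex.abs_im_le_norm) (fun z hz h0 => ?_) n
    have h1 := Complex.hasSum_im (hzero z hz h0)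
    simp only [Complex.im_ofReal_mul, Complex.zero_im] at h1
    rw [← h1.tsum_eq]
    exact tsum_congr fun n => by ring

/-- The mass of the measure `besselMeasure q α` at `q^n`. -/
def besselMass (q α : ℝ) (n : ℕ) : ℝ :=
  (1 - q) * q ^ n * besselWeight q α (q ^ n)

lemma besselMass_eq (hq0 : 0 < q) (α : ℝ) (n : ℕ) :
    besselMass q α n
      = (1 - q) * ((q ^ 2) ^ n * latticeWeight (q ^ 2) (q ^ (2 * α + 2)) ((q ^ 2) ^ n)) := by
  rw [← besselWeight_pow hq0, besselMass]
  ring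

lemma besselMass_nonneg (hq0 : 0 < q) (hq1 : q < 1) (hα : -(3 / 2) < α) (n : ℕ) :
    0 ≤ besselMass q α n := by
  obtain ⟨C, -, hC⟩ := exists_latticeWeight_bounds hq0 hq1 hα
  rw [besselMass_eq hq0]
  exact mul_nonneg (by linarith) (mul_nonneg (by positivity) (hC n).1.le)

lemma isFiniteMeasure_besselMeasure (hq0 : 0 < q) (hq1 : q < 1) (hα : -(3 / 2) < α) :
    IsFiniteMeasure (besselMeasure q α) := by
  obtain ⟨C, -, hC⟩ := exists_latticeWeight_bounds hq0 hq1 hα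
  have hp1 : q ^ 2 < 1 := pow_lt_one₀ hq0.le hq1 two_ne_zero
  have hs : Summable (besselMass q α) := by
    refine Summable.of_nonneg_of_le (besselMass_nonneg hq0 hq1 hα) (fun n => ?_)
      (((summable_geometric_of_lt_one (by positivity) hp1).mul_right C).mul_left (1 - q))
    rw [besselMass_eq hq0]
    exact mul_le_mul_of_nonneg_left (mul_le_mul_of_nonneg_left (hC n).2.1 (by positivity))
      (by linarith)
  refine ⟨?_⟩
  rw [besselMeasure, Measure.sum_apply _ MeasurableSet.univ]
  simp only [Measure.smul_apply, measure_univ, smul_eq_mul, mul_one]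
  exact hs.tsum_ofReal_lt_top

lemma ae_besselMeasure {P : ℝ → Prop} (h : ∀ n : ℕ, P (q ^ n)) :
    ∀ᵐ x ∂(besselMeasure q α), P x := by
  rw [besselMeasure, Measure.ae_sum_iff]
  intro n
  refine Measure.ae_smul_measure ?_ _
  rw [ae_dirac_eq]
  exact h n

lemma aestronglyMeasurable_besselMeasure (f : ℝ → ℂ) :
    AEStronglyMeasurable f (besselMeasure q α) := by
  rw [besselMeasure, aestronglyMeasurable_sum_measure_iff]
  exact fun n => aestronglyMeasurable_dirac.smul_measure _

lemma hasSum_integral_besselMeasure {E : Type*} [NormedAddCommGroup E] [NormedSpace ℝ E]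
    [CompleteSpace E] (hq0 : 0 < q) (hq1 : q < 1)
    (hα : -(3 / 2) < α) {f : ℝ → E} (hf : Integrable f (besselMeasure q α)) :
    HasSum (fun n : ℕ => besselMass q α n • f (q ^ n)) (∫ x, f x ∂(besselMeasure q α)) := by
  refine (hasSum_integral_measure hf).congr_fun fun n => ?_
  rw [integral_smul_measure, integral_dirac, ← besselMass,
    ENNReal.toReal_ofReal (besselMass_nonneg hq0 hq1 hα n)]

lemma memLp_bigQBessel (hq0 : 0 < q) (hq1 : q < 1) (hα : -(3 / 2) < α) (l : ℝ) :
    MemLp (fun x : ℝ => bigQBessel q (α + 1) (x : ℂ) (l : ℂ)) 2 (besselMeasure q α) := by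
  have := isFiniteMeasure_besselMeasure hq0 hq1 hα
  obtain ⟨C, hC⟩ := exists_norm_bigQBessel_le hq0 hq1 hα l
  exact MemLp.of_bound (aestronglyMeasurable_besselMeasure _) C
    (ae_besselMeasure (P := fun x => ‖bigQBessel q (α + 1) (x : ℂ) (l : ℂ)‖ ≤ C) hC)

lemma summable_sq_of_Lp (hq0 : 0 < q) (hq1 : q < 1) (hα : -(3 / 2) < α)
    (f : Lp ℂ 2 (besselMeasure q α)) : Summable fun n : ℕ => (q ^ 2) ^ n * ‖f (q ^ n)‖ ^ 2 := by
  obtain ⟨C, hC0, hC⟩ := exists_latticeWeight_bounds hq0 hq1 hα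
  have h1 := (hasSum_integral_besselMeasure hq0 hq1 hα
    ((Lp.memLp f).integrable_norm_pow two_ne_zero)).summable.mul_left (C / (1 - q))
  refine Summable.of_nonneg_of_le (fun n => by positivity) (fun n => ?_) h1
  have hq : 0 < 1 - q := by linarith
  rw [besselMass_eq hq0, smul_eq_mul]
  have h2 := mul_le_mul_of_nonneg_left (hC n).2.2
    (show 0 ≤ (q ^ 2) ^ n * ‖f (q ^ n)‖ ^ 2 by positivity)
  calc _ ≤ _ := by simpa using h2
    _ = _ := by field_simp; ring

end translation

end

theorem theorem4p4 (q α : ℝ) (hq0 : 0 < q) (hq1 : q < 1) (hα : -(3 / 2) < α) (hα1 : α ≠ -1) :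
    (∀ g : ℝ → ℂ, QIntegrable q 1 g →
      (∀ j ∈ besselZeros q α,
        qIntegral q 1 (fun x => (besselWeight q α x : ℂ) * g x
          * bigQBessel q (α + 1) (x : ℂ) (j : ℂ)) = 0) →
      ∀ m : ℕ, g (q ^ m) = 0) ∧
    (Submodule.span ℂ {f : Lp ℂ 2 (besselMeasure q α) | ∃ j ∈ besselZeros q α,
        f =ᵐ[besselMeasure q α] fun x : ℝ => bigQBessel q (α + 1) (x : ℂ) (j : ℂ)}).topologicalClosure
      = ⊤ := by
  constructor
  · intro g hg h m
    refine eq_zero_of_forall_besselZeros hq0 hq1 hα hα1 (g := fun n => g (q ^ n)) ?_ ?_ m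
    · -- `ℓ¹ ⊆ ℓ²` for the sequence `q^n ‖g(q^n)‖`
      have hg' : Summable fun n : ℕ => ‖g (q ^ n)‖ * q ^ n := by
        simpa only [QIntegrable, one_mul] using hg
      have hnn : ∀ n : ℕ, 0 ≤ ‖g (q ^ n)‖ * q ^ n := fun n => by positivity
      refine Summable.of_nonneg_of_le (fun n => by positivity) (fun n => ?_)
        (hg'.mul_left (∑' n : ℕ, ‖g (q ^ n)‖ * q ^ n))
      calc (q ^ 2) ^ n * ‖g (q ^ n)‖ ^ 2 = (‖g (q ^ n)‖ * q ^ n) * (‖g (q ^ n)‖ * q ^ n) := by ring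
        _ ≤ _ := mul_le_mul_of_nonneg_right (hg'.le_tsum n fun k _ => hnn k) (hnn n)
    · intro j hj
      have h1 := h j hj
      rw [qIntegral, Complex.ofReal_one, mul_one] at h1
      have hq : (1 - (q : ℂ)) ≠ 0 := sub_ne_zero.2 (by exact_mod_cast hq1.ne')
      rw [← (mul_eq_zero.1 h1).resolve_left hq]
      refine tsum_congr fun n => ?_
      rw [one_mul]
      push_cast
      ring
  · rw [Submodule.topologicalClosure_eq_top_iff, Submodule.eq_bot_iff]
    intro f hf
    have hzero : ∀ n : ℕ, f (q ^ n) = 0 := by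
      refine eq_zero_of_forall_besselZeros hq0 hq1 hα hα1 (summable_sq_of_Lp hq0 hq1 hα f) ?_
      intro j hj
      have hu := memLp_bigQBessel hq0 hq1 hα j
      have h1 : inner ℂ (hu.toLp _) f = 0 :=
        (Submodule.mem_orthogonal _ _).1 hf _ (Submodule.subset_span ⟨j, hj, hu.coeFn_toLp⟩)
      have h2 := L2.integrable_inner (𝕜 := ℂ) (hu.toLp _) f
      rw [L2.inner_def] at h1
      have hae : (fun x => inner ℂ ((hu.toLp _ : Lp ℂ 2 (besselMeasure q α)) x) (f x))
          =ᵐ[besselMeasure q α]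
          fun x : ℝ => inner ℂ (bigQBessel q (α + 1) (x : ℂ) (j : ℂ)) (f x) := by
        filter_upwards [hu.coeFn_toLp] with x hx
        rw [hx]
      rw [integral_congr_ae hae] at h1
      have h3 := hasSum_integral_besselMeasure hq0 hq1 hα (h2.congr hae)
      rw [h1] at h3
      have hq : (1 - (q : ℂ)) ≠ 0 := sub_ne_zero.2 (by exact_mod_cast hq1.ne')
      refine mul_left_cancel₀ hq ?_
      rw [mul_zero, ← h3.tsum_eq, ← tsum_mul_left]
      refine tsum_congr fun n => ?_
      -- the function is real on the lattice, so the conjugation in the inner product is harmless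
      rw [bigQBessel_succ_ofReal hq0 α (pow_pos hq0 n).ne', RCLike.inner_apply, Complex.conj_ofReal,
        Complex.real_smul, besselMass]
      push_cast
      ring
    rw [Lp.eq_zero_iff_ae_eq_zero]
    exact ae_besselMeasure (P := fun x => f x = 0) hzero
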